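/- A weighted graph $(E,\omega)$ consists of countable sets $E^0$ (vertices) and $E^{\mathrm{st}}$ (structured edges), maps $s,r:E^{\mathrm{st}}\to E^0$ and a weight map $\omega:E^{\mathrm{st}}\to\{1,2,3,\dots\}$. It is assumed to be row-finite, i.e. $s^{-1}(v)$ is finite for every $v\in E^0$. For $v$ not a sink (i.e. $s^{-1}(v)\neq\emptyset$) put $\omega(v)=\max\{\omega(\alpha)\mid\alpha\in s^{-1}(v)\}$. Let $E^1$ be the set of edges $\alpha_i$ with $\alpha\in E^{\mathrm{st}}$, $1\le i\le\omega(\alpha)$, and $(E^1)^*$ the set of symbols $\alpha_i^*$ with $\alpha_i\in E^1$, these edges and symbols being pairwise distinct and distinct from the vertices. For a unital (not necessarily commutative) ring $R$, the weighted Leavitt path algebra $L_R(E,\omega)$ is the (not necessarily unital) ring $R\langle X\rangle/I$. Here $R\langle X\rangle$ is the free left $R$-module on the nonempty words over $X=E^0\sqcup E^1\sqcup(E^1)^*$, with multiplication $(\sum_x r_x x)(\sum_y t_y y)=\sum_{x,y} r_xt_y\,xy$ and right action $(\sum_x r_x x)t=\sum_x r_xt\,x$ of $R$, and $I$ is the two-sided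 ideal and $R$-subbimodule generated by the relations 1. $vw=\delta_{vw}v$ for all $v,w\in E^0$; 2. $s(\alpha)\alpha_i=\alpha_i=\alpha_i r(\alpha)$ and $r(\alpha)\alpha_i^*=\alpha_i^*=\alpha_i^*s(\alpha)$ for all $\alpha\in E^{\mathrm{st}}$ and $1\le i\le\omega(\alpha)$; 3. $\sum_{\alpha\in s^{-1}(v)}\alpha_i\alpha_j^*=\delta_{ij}v$ for all $v\in E^0$ that are not sinks and $1\le i,j\le\omega(v)$; 4. $\sum_{1\le i\le\max\{\omega(\alpha),\omega(\beta)\}}\alpha_i^*\beta_i=\delta_{\alpha\beta}r(\alpha)$ for all $\alpha,\beta\in E^{\mathrm{st}}$; where in (3) and (4) $\alpha_i$ and $\alpha_i^*$ are read as $0$ if $i>\omega(\alpha)$. $(E,\omega)$ is called an LV-graph if $E^{\mathrm{st}}\ne\emptyset$, $(E,\omega)$ is connected (any two vertices are joined by a path in which structured edges may be traversed in either direction), $\omega(\alpha)\ge2$ for all $\alpha\in E^{\mathrm{st}}$, and for every $v\in E^0$ that is not a sink there are at least two $\alpha\in s^{-1}(v)$ with $\omega(\alpha)=\omega(v)$.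 The Jacobson radical of a not necessarily unital ring $A$ is the sum of all left ideals of $A$ each of whose elements $a$ is left quasi-regular, i.e. satisfies $b+a=ba$ for some $b\in A$. **Theorem.** Let $(E,\omega)$ be an LV-graph and let $R$ be a domain (a nonzero, not necessarily commutative, unital ring without zero divisors). Then the Jacobson radical of $L_R(E,\omega)$ is zero. -/

import Mathlib

open scoped MulOpposite

/-- A row-finite weighted graph with vertex set `V` and set of structured edges `S`.
A structured edge `α` stands for the `ω α ≥ 1` edges `α₁, …, α_{ω α}`; these are indexed here by
`Fin (ω α)`, so that the index `i : Fin (ω α)` denotes the edge `α_{i+1}`. -/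
structure WeightedGraph (V : Type*) (S : Type*) where
  /-- the source map -/
  s : S → V
  /-- the range map -/
  r : S → V
  /-- the weight map -/
  ω : S → ℕ
  ω_pos : ∀ α, 1 ≤ ω α
  /-- row-finiteness: every vertex emits only finitely many structured edges -/
  finite_out : ∀ v, {α | s α = v}.Finite

namespace WeightedGraph

variable {V S : Type*} (E : WeightedGraph V S)

/-- The finite set `s⁻¹(v)`. -/
noncomputable def out (v : V) : Finset S := (E.finite_out v).toFinset

/-- `ω(v) = max {ω(α) | α ∈ s⁻¹(v)}` if `v` is not a sink (and `0` if `v` is a sink). -/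
noncomputable def vertexWeight (v : V) : ℕ := (E.out v).sup E.ω

/-- There is an element `x` of `E¹ ∪ (E¹)*` with `s(x) = u` and `r(x) = v`, where
`s(αᵢ) = s(α)`, `r(αᵢ) = r(α)`, `s(αᵢ*) = r(α)` and `r(αᵢ*) = s(α)`. -/
def Step (u v : V) : Prop :=
  ∃ (α : S) (_ : Fin (E.ω α)), (E.s α = u ∧ E.r α = v) ∨ (E.r α = u ∧ E.s α = v)

/-- There is a generalised path (possibly of length zero) from `u` to `v`. -/
def Reach (u v : V) : Prop := Relation.ReflTransGen E.Step u v

/-- LV-graphs: connected weighted graphs that have edges and satisfy condition (LV). -/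
structure IsLVGraph : Prop where
  two_le_weight : ∀ α, 2 ≤ E.ω α
  two_le_card : ∀ v, (E.out v).Nonempty →
    2 ≤ ((E.out v).filter fun α => E.ω α = E.vertexWeight v).card
  has_edges : Nonempty S
  connected : ∀ u v, E.Reach u v

/-- The set of generators `X = E⁰ ⊔ E¹ ⊔ (E¹)*`. -/
inductive Gen : Type _
  | vertex (v : V) : Gen
  | edge (α : S) (i : Fin (E.ω α)) : Gen
  | ghost (α : S) (i : Fin (E.ω α)) : Gen

variable (R : Type*) [Ring R]

/-- The free (nonunital) `R`-ring `R⟨X⟩`: the free left `R`-module on the nonempty words over `X`,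
with `(r x) (s y) = (r s) (x y)` for `r s : R` and words `x y`. -/
abbrev FreeRRing : Type _ := MonoidAlgebra R (FreeSemigroup E.Gen)

/-- A generator as an element of `R⟨X⟩`. -/
noncomputable def ι (x : E.Gen) : E.FreeRRing R := MonoidAlgebra.single (FreeSemigroup.of x) 1

/-- The vertex `v` in `R⟨X⟩`. -/
noncomputable def vtx (v : V) : E.FreeRRing R := E.ι R (.vertex v)

/-- The element `α_{i+1}` of `R⟨X⟩`, which is zero if `i + 1 > ω(α)`. -/
noncomputable def edg (α : S) (i : ℕ) : E.FreeRRing R :=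
  if h : i < E.ω α then E.ι R (.edge α ⟨i, h⟩) else 0

/-- The element `α_{i+1}*` of `R⟨X⟩`, which is zero if `i + 1 > ω(α)`. -/
noncomputable def gho (α : S) (i : ℕ) : E.FreeRRing R :=
  if h : i < E.ω α then E.ι R (.ghost α ⟨i, h⟩) else 0

open Classical in
/-- The defining relations (1)-(4) of the weighted Leavitt path algebra. -/
inductive Rel : E.FreeRRing R → E.FreeRRing R → Prop
  | vertex_mul (v w : V) : Rel (E.vtx R v * E.vtx R w) (if v = w then E.vtx R v else 0)
  | source_mul_edge (α : S) (i : ℕ) (hi : i < E.ω α) :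
      Rel (E.vtx R (E.s α) * E.edg R α i) (E.edg R α i)
  | edge_mul_range (α : S) (i : ℕ) (hi : i < E.ω α) :
      Rel (E.edg R α i * E.vtx R (E.r α)) (E.edg R α i)
  | range_mul_ghost (α : S) (i : ℕ) (hi : i < E.ω α) :
      Rel (E.vtx R (E.r α) * E.gho R α i) (E.gho R α i)
  | ghost_mul_source (α : S) (i : ℕ) (hi : i < E.ω α) :
      Rel (E.gho R α i * E.vtx R (E.s α)) (E.gho R α i)
  | sum_edge_ghost (v : V) (i j : ℕ) (hi : i < E.vertexWeight v) (hj : j < E.vertexWeight v) :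
      Rel (∑ α ∈ E.out v, E.edg R α i * E.gho R α j) (if i = j then E.vtx R v else 0)
  | sum_ghost_edge (α β : S) :
      Rel (∑ i ∈ Finset.range (max (E.ω α) (E.ω β)), E.gho R α i * E.edg R β i)
        (if α = β then E.vtx R (E.r α) else 0)

/-- The ideal of the `R`-ring `R⟨X⟩` generated by the defining relations: the smallest two-sided
ideal which is an `R`-subbimodule and contains all the relations. -/
noncomputable def relIdeal : TwoSidedIdeal (E.FreeRRing R) :=
  sInf {I | (∀ a b, E.Rel R a b → a - b ∈ I) ∧
    (∀ (c : R), ∀ a ∈ I, c • a ∈ I ∧ MulOpposite.op c • a ∈ I)}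

/-- The weighted Leavitt path algebra `L_R(E, ω) = R⟨X⟩ / I`. -/
abbrev LeavittPathAlgebra : Type _ := (E.relIdeal R).ringCon.Quotient

end WeightedGraph

section JacobsonRadical

variable {A : Type*} [NonUnitalRing A]

/-- An element `a` of a (not necessarily unital) ring is left quasi-regular if `b + a = b a` for
some `b`. -/
def IsLeftQuasiregular (a : A) : Prop := ∃ b : A, b + a = b * a

/-- An additive subgroup of `A` is a left quasi-regular left ideal. -/
structure IsLeftQuasiregularLeftIdeal (I : AddSubgroup A) : Prop where
  mul_mem : ∀ (x : A), ∀ a ∈ I, x * a ∈ I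
  quasiregular : ∀ a ∈ I, IsLeftQuasiregular a

variable (A) in
/-- The Jacobson radical of a not necessarily unital ring: the sum of all its left quasi-regular
left ideals. -/
def jacobsonRadical : AddSubgroup A := sSup {I | IsLeftQuasiregularLeftIdeal I}

end JacobsonRadical

/-!
The edges `αᵢ` of a weighted graph are the edges of a bipartite graph, between the rows `(v, i)` and
the columns `α`, in which `αᵢ` and `αᵢ*` are the two orientations of one edge. Relations (3) and
(4) then become one relation: `∑ (a → b)(b → c)`, over the neighbours `b` of `a`, is a vertex if
`a = c` and zero otherwise. Choosing a pivot `b` for every `a` and solving for the summand at `b`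
yields a rewriting system, whose normal words form a basis of the algebra.

In a product of two elements, words of maximal length are rewritten only where they are glued
together. Condition (LV) provides common neighbours other than the pivot, so over a domain the
leading terms cannot all cancel, and the degree is additive. Now let `m` be an element of positive
degree in the corner at a vertex. In an equation `n + m = n m`, additivity of the degree forces `n`
to be a scalar, and comparing coefficients shows that this scalar is `1`, hence `m` is not left
quasi-regular. Every nonzero left ideal contains an `x` that acts on the trivial path at some `v`
as such an `m`.
-/

theorem jacobsonRadical_eq_bot_of_exists_mul {A : Type*} [NonUnitalRing A]
    (h : ∀ a : A, a ≠ 0 → ∃ x, ¬IsLeftQuasiregular (x * a)) : jacobsonRadical A = ⊥ := by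
  refine sSup_eq_bot.2 fun I hI => (AddSubgroup.eq_bot_iff_forall I).2 fun a ha => ?_
  by_contra ha₀
  obtain ⟨x, hx⟩ := h a ha₀
  exact hx (hI.quasiregular _ (hI.mul_mem x a ha))

/-- A locally finite graph on a set `N` of nodes, each lying over a vertex in `V`, in which all the
nodes of a connected component at even distance from each other share a distinguished common
neighbour, their pivot. It encodes a weighted graph together with a choice of the words to be
rewritten: see `WeightedGraph.bipartite`. The value of `pivot` at an isolated node is irrelevant. -/
structure PivotedGraph (V N : Type*) where
  base : N → V
  nbr : N → Finset N
  pivot : N → N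
  mem_nbr_symm : ∀ {a b}, b ∈ nbr a → a ∈ nbr b
  pivot_mem_nbr : ∀ {a b}, b ∈ nbr a → pivot a ∈ nbr a
  pivot_eq : ∀ {a b c}, b ∈ nbr a → c ∈ nbr b → pivot c = pivot a

namespace PivotedGraph

open scoped Classical

variable {V N : Type*} (P : PivotedGraph V N)

/-- The vertex at which a word in the arrows `(a, b)`, from `base a` to `base b`, starts. The empty
word is the trivial path at `v`. -/
def start (v : V) : List (N × N) → V
  | [] => v
  | x :: _ => P.base x.1

/-- The arrow `(a, b)` followed by the word `l` is to be rewritten: `l` starts with an arrow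
`(b, c)`, and `b` is the pivot of `a`. -/
def Clash (a b : N) (l : List (N × N)) : Prop :=
  b = P.pivot a ∧ l.head?.map Prod.fst = some b

/-- The words in normal form that are paths ending at the vertex `v`. -/
def IsNormal (v : V) : List (N × N) → Prop
  | [] => True
  | x :: l => x.2 ∈ P.nbr x.1 ∧ P.base x.2 = P.start v l ∧ ¬P.Clash x.1 x.2 l ∧ IsNormal v l

variable {P} {v : V} {a b c d : N} {l : List (N × N)}

theorem not_clash_nil : ¬P.Clash a b [] := by simp [Clash]

theorem clash_cons {x : N × N} : P.Clash a b (x :: l) ↔ b = P.pivot a ∧ x.1 = b := by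
  simp [Clash]

theorem isNormal_nil : P.IsNormal v [] := trivial

theorem isNormal_cons :
    P.IsNormal v ((a, b) :: l) ↔
      b ∈ P.nbr a ∧ P.base b = P.start v l ∧ ¬P.Clash a b l ∧ P.IsNormal v l :=
  Iff.rfl

theorem IsNormal.of_cons {x : N × N} (h : P.IsNormal v (x :: l)) : P.IsNormal v l := h.2.2.2

theorem IsNormal.of_append {p : List (N × N)} (h : P.IsNormal v (p ++ l)) : P.IsNormal v l := by
  induction p with
  | nil => exact h
  | cons x p ih => exact ih h.of_cons

/-- All neighbours of `b` have the same pivot. -/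
theorem IsNormal.congr_left (h : P.IsNormal v ((a, b) :: l)) (hb : b ∈ P.nbr c) :
    P.IsNormal v ((c, b) :: l) := by
  refine ⟨hb, h.2.1, ?_, h.of_cons⟩
  have hpivot := P.pivot_eq hb (P.mem_nbr_symm h.1)
  simpa only [Clash, hpivot] using h.2.2.1

section PathModule

variable (P) (R : Type*) [Ring R]

/-- The free left `R`-module on the normal words ending at `v`. -/
abbrev PathModule (v : V) : Type _ := {l : List (N × N) // P.IsNormal v l} →₀ R

/-- The basis vector of a word in normal form, and zero for all other words. -/
noncomputable def word (v : V) (l : List (N × N)) : P.PathModule R v :=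
  if h : P.IsNormal v l then Finsupp.single ⟨l, h⟩ 1 else 0

/-- The reduced form of the product of the arrow `(a, b)` and a normal word. -/
noncomputable def arrowMulWord (v : V) (a b : N) : List (N × N) → P.PathModule R v
  | [] => P.word R v [(a, b)]
  | (b', c) :: l =>
    if b = P.pivot a ∧ b' = b then
      (if a = c then P.word R v l else 0) -
        ∑ e ∈ (P.nbr a).erase b, P.word R v ((a, e) :: (e, c) :: l)
    else P.word R v ((a, b) :: (b', c) :: l)

/-- Left multiplication by the arrow `(a, b)`. -/
noncomputable def act (v : V) (a b : N) : Module.End R (P.PathModule R v) :=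
  Finsupp.linearCombination R fun l => P.arrowMulWord R v a b l.1

/-- Left multiplication by the vertex `u`: the projection onto the words that start at `u`. -/
noncomputable def proj (v u : V) : Module.End R (P.PathModule R v) :=
  Finsupp.linearCombination R fun l => if P.start v l.1 = u then P.word R v l.1 else 0

variable {P R} {M : Type*} [AddCommGroup M] [Module R M]

theorem word_of_not_isNormal (h : ¬P.IsNormal v l) : P.word R v l = 0 := dif_neg h

theorem linearCombination_word {f : List (N × N) → M} (h : P.IsNormal v l) :
    Finsupp.linearCombination R (fun l : {l // P.IsNormal v l} => f l.1) (P.word R v l) = f l := by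
  simp [word, h]

theorem pathModule_hom_ext {f g : P.PathModule R v →ₗ[R] M}
    (h : ∀ l, P.IsNormal v l → f (P.word R v l) = g (P.word R v l)) : f = g :=
  Finsupp.lhom_ext' fun l => LinearMap.ext_ring <| by simpa [word, l.2] using h l.1 l.2

theorem proj_word (u : V) :
    P.proj R v u (P.word R v l) = if P.start v l = u then P.word R v l else 0 := by
  by_cases h : P.IsNormal v l
  · exact linearCombination_word
      (f := fun l => if P.start v l = u then P.word R v l else 0) h
  · simp [word_of_not_isNormal h]

theorem act_word (h : P.IsNormal v l) :
    P.act R v a b (P.word R v l) = P.arrowMulWord R v a b l :=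
  linearCombination_word (f := P.arrowMulWord R v a b) h

theorem act_word_of_not_clash (h : ¬P.Clash a b l) :
    P.act R v a b (P.word R v l) = P.word R v ((a, b) :: l) := by
  by_cases hl : P.IsNormal v l
  · rw [act_word hl]
    match l with
    | [] => rfl
    | (b', c) :: l => exact if_neg (by simpa only [clash_cons] using h)
  · rw [word_of_not_isNormal hl, map_zero, word_of_not_isNormal fun h => hl h.of_cons]

theorem act_pivot_word (h : P.IsNormal v ((P.pivot a, c) :: l)) :
    P.act R v a (P.pivot a) (P.word R v ((P.pivot a, c) :: l)) =
      (if a = c then P.word R v l else 0) -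
        ∑ e ∈ (P.nbr a).erase (P.pivot a), P.word R v ((a, e) :: (e, c) :: l) :=
  (act_word h).trans (if_pos ⟨rfl, rfl⟩)

theorem exists_of_clash (h : P.Clash a b l) : b = P.pivot a ∧ ∃ c l', l = (P.pivot a, c) :: l' := by
  obtain ⟨rfl, h⟩ := h
  match l, h with
  | (_, c) :: l', rfl => exact ⟨rfl, c, l', rfl⟩

theorem word_cons_eq_zero (h : b ∉ P.nbr a) : P.word R v ((a, b) :: l) = 0 :=
  word_of_not_isNormal fun hl => h hl.1

theorem act_eq_zero (h : b ∉ P.nbr a) : P.act R v a b = 0 := by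
  refine pathModule_hom_ext fun l hl => ?_
  rw [LinearMap.zero_apply]
  by_cases hc : P.Clash a b l
  · obtain ⟨rfl, c, l, rfl⟩ := exists_of_clash hc
    have hnbr : P.nbr a = ∅ :=
      Finset.eq_empty_of_forall_notMem fun e he => h (P.pivot_mem_nbr he)
    have hac : a ≠ c := by
      rintro rfl
      exact h (P.mem_nbr_symm hl.1)
    simp [act_pivot_word hl, hnbr, hac]
  · rw [act_word_of_not_clash hc, word_cons_eq_zero h]

theorem proj_mul_self (u : V) : P.proj R v u * P.proj R v u = P.proj R v u := by
  refine pathModule_hom_ext fun l _ => ?_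
  by_cases h : P.start v l = u <;> simp [proj_word, h]

theorem proj_mul_of_ne {u w : V} (h : u ≠ w) : P.proj R v u * P.proj R v w = 0 := by
  refine pathModule_hom_ext fun l _ => ?_
  by_cases hw : P.start v l = w <;> simp [proj_word, hw, h.symm]

theorem proj_base_word_cons :
    P.proj R v (P.base a) (P.word R v ((a, b) :: l)) = P.word R v ((a, b) :: l) :=
  (proj_word _).trans (if_pos rfl)

theorem proj_mul_act : P.proj R v (P.base a) * P.act R v a b = P.act R v a b := by
  refine pathModule_hom_ext fun l hl => ?_
  rw [Module.End.mul_apply]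
  by_cases hc : P.Clash a b l
  · obtain ⟨rfl, c, l, rfl⟩ := exists_of_clash hc
    rw [act_pivot_word hl, map_sub, map_sum]
    simp only [proj_base_word_cons]
    split_ifs with hac
    · rw [proj_word, if_pos (hac ▸ hl.2.1.symm)]
    · rw [map_zero]
  · rw [act_word_of_not_clash hc, proj_base_word_cons]

theorem act_mul_proj : P.act R v a b * P.proj R v (P.base b) = P.act R v a b := by
  refine pathModule_hom_ext fun l _ => ?_
  rw [Module.End.mul_apply, proj_word]
  split_ifs with hstart
  · rfl
  · rw [map_zero, act_word_of_not_clash, word_of_not_isNormal]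
    · exact fun hl => hstart hl.2.1.symm
    · intro hc
      obtain ⟨rfl, c, l, rfl⟩ := exists_of_clash hc
      exact hstart rfl

/-- Once the summand at the pivot is rewritten, it cancels all the others. -/
theorem sum_act_word_cons (ha : (P.nbr a).Nonempty)
    (hl : P.IsNormal v l) (hstart : P.start v l = P.base c)
    (hc : ∀ b ∈ P.nbr a, ¬P.Clash b c l) :
    ∑ b ∈ P.nbr a, P.act R v a b (P.word R v ((b, c) :: l)) =
      if a = c then P.word R v l else 0 := by
  obtain ⟨b₀, hb₀⟩ := ha
  have hpivot := P.pivot_mem_nbr hb₀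
  rw [← Finset.add_sum_erase _ _ hpivot,
    Finset.sum_congr rfl fun b hb => act_word_of_not_clash fun h => Finset.ne_of_mem_erase hb h.1]
  by_cases hcp : c ∈ P.nbr (P.pivot a)
  · rw [act_pivot_word ⟨hcp, hstart.symm, hc _ hpivot, hl⟩, sub_add_cancel]
  · have hac : a ≠ c := by
      rintro rfl
      exact hcp (P.mem_nbr_symm hpivot)
    rw [word_cons_eq_zero hcp, map_zero, zero_add, if_neg hac]
    refine Finset.sum_eq_zero fun b hb => word_of_not_isNormal fun h => hcp ?_
    have hb : b ∈ P.nbr a := Finset.mem_of_mem_erase hb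
    have hbc : c ∈ P.nbr b := h.of_cons.1
    exact P.mem_nbr_symm (P.pivot_eq hb hbc ▸ P.pivot_mem_nbr (P.mem_nbr_symm hbc))

theorem sum_act_act_word_of_clash (ha : (P.nbr a).Nonempty)
    (hl : P.IsNormal v ((c, d) :: l)) (hc : ∀ b ∈ P.nbr a, c = P.pivot b) :
    ∑ b ∈ P.nbr a, P.act R v a b (P.act R v b c (P.word R v ((c, d) :: l))) =
      if a = c then P.word R v ((c, d) :: l) else 0 := by
  have hact : ∀ b ∈ P.nbr a, P.act R v b c (P.word R v ((c, d) :: l)) =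
      (if b = d then P.word R v l else 0) -
        ∑ e ∈ (P.nbr d).erase c, P.word R v ((b, e) :: (e, d) :: l) := by
    intro b hb
    obtain rfl := hc b hb
    rw [act_pivot_word hl]
    congr 1
    refine Finset.sum_congr_of_eq_on_inter ?_ ?_ fun _ _ _ => rfl
    · intro e he hed
      refine word_of_not_isNormal fun h => hed ?_
      exact Finset.mem_erase.2 ⟨Finset.ne_of_mem_erase he, P.mem_nbr_symm h.of_cons.1⟩
    · intro e he heb
      exact word_cons_eq_zero fun h => heb (Finset.mem_erase.2 ⟨Finset.ne_of_mem_erase he, h⟩)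
  have hsum : ∀ e ∈ (P.nbr d).erase c,
      ∑ b ∈ P.nbr a, P.act R v a b (P.word R v ((b, e) :: (e, d) :: l)) =
        if a = e then P.word R v ((a, d) :: l) else 0 := by
    intro e he
    obtain ⟨hec, hed⟩ := Finset.mem_erase.1 he
    rw [sum_act_word_cons ha (hl.congr_left (P.mem_nbr_symm hed)) rfl fun b hb hclash =>
      hec (hclash.1.trans (hc b hb).symm)]
    split_ifs with hae
    · rw [hae]
    · rfl
  have hd : ∑ b ∈ P.nbr a, P.act R v a b (if b = d then P.word R v l else 0) =
      P.word R v ((a, d) :: l) := by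
    simp only [apply_ite, map_zero, Finset.sum_ite_eq']
    split_ifs with had
    · exact act_word_of_not_clash (hl.congr_left had).2.2.1
    · rw [word_cons_eq_zero had]
  rw [Finset.sum_congr rfl fun b hb => by rw [hact b hb, map_sub, map_sum],
    Finset.sum_sub_distrib, Finset.sum_comm, Finset.sum_congr rfl hsum, hd,
    Finset.sum_ite_eq]
  simp only [Finset.mem_erase]
  by_cases hac : a = c
  · simp [hac]
  · by_cases had : a ∈ P.nbr d
    · simp [hac, had]
    · simp [hac, had, word_cons_eq_zero (mt P.mem_nbr_symm had)]

theorem sum_act_mul_act (ha : (P.nbr a).Nonempty) :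
    ∑ b ∈ P.nbr a, P.act R v a b * P.act R v b c = if a = c then P.proj R v (P.base a) else 0 := by
  refine pathModule_hom_ext fun l hl => ?_
  suffices ∑ b ∈ P.nbr a, P.act R v a b (P.act R v b c (P.word R v l)) =
      if a = c then P.proj R v (P.base c) (P.word R v l) else 0 by
    rw [LinearMap.sum_apply]
    split_ifs at this ⊢ with hac
    · rwa [hac] at this ⊢
    · exact this
  rw [proj_word]
  by_cases hclash : ∃ b ∈ P.nbr a, P.Clash b c l
  · obtain ⟨b, hb, hbc⟩ := hclash
    obtain ⟨rfl, d, l, rfl⟩ := exists_of_clash hbc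
    rw [sum_act_act_word_of_clash ha hl fun b' hb' => P.pivot_eq (P.mem_nbr_symm hb') hb]
    exact if_congr Iff.rfl (if_pos rfl).symm rfl
  · push Not at hclash
    rw [Finset.sum_congr rfl fun b hb => by rw [act_word_of_not_clash (hclash b hb)]]
    by_cases hstart : P.start v l = P.base c
    · rw [sum_act_word_cons ha hl hstart hclash, if_pos hstart]
    · rw [if_neg hstart, ite_self]
      refine Finset.sum_eq_zero fun b _ => ?_
      rw [word_of_not_isNormal fun h => hstart (isNormal_cons.1 h).2.1.symm, map_zero]

end PathModule

variable {u w : V} {p q : List (N × N)}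

theorem IsNormal.append_cons (hp : P.IsNormal u (p ++ [(a, b)]))
    (hl : P.IsNormal v ((a, c) :: l)) : P.IsNormal v (p ++ (a, c) :: l) := by
  induction p with
  | nil => exact hl
  | cons x p ih =>
    refine ⟨hp.1, ?_, ?_, ih hp.of_cons⟩
    · have hbase := hp.2.1
      cases p <;> exact hbase
    · have hclash := hp.2.2.1
      cases p <;> exact hclash

theorem IsNormal.base_eq (hp : P.IsNormal u (p ++ [(a, b)])) : P.base b = u :=
  hp.of_append.2.1

theorem IsNormal.last_mem_nbr (hp : P.IsNormal u (p ++ [(a, b)])) : b ∈ P.nbr a :=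
  hp.of_append.1

section ActWord

variable (P) (R : Type*) [Ring R]

/-- Left multiplication by a word. -/
noncomputable def actWord (v : V) (p : List (N × N)) : Module.End R (P.PathModule R v) :=
  (p.map fun x => P.act R v x.1 x.2).prod

/-- Right multiplication by the element `m`: the words ending at `u` act on `m`. -/
noncomputable def mulRight (u : V) {v : V} (m : P.PathModule R v) :
    P.PathModule R u →ₗ[R] P.PathModule R v :=
  Finsupp.linearCombination R fun p => P.actWord R v p.1 m

variable {P R}

theorem actWord_nil : P.actWord R v [] = 1 := rfl

theorem actWord_cons : P.actWord R v ((a, b) :: p) = P.act R v a b * P.actWord R v p := by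
  simp [actWord]

theorem actWord_append : P.actWord R v (p ++ q) = P.actWord R v p * P.actWord R v q := by
  simp [actWord]

theorem mulRight_word {m : P.PathModule R v} (h : P.IsNormal u p) :
    P.mulRight R u m (P.word R u p) = P.actWord R v p m :=
  linearCombination_word (f := fun p => P.actWord R v p m) h

theorem mulRight_zero : P.mulRight R u (0 : P.PathModule R v) = 0 :=
  pathModule_hom_ext fun p hp => by rw [mulRight_word hp, map_zero, LinearMap.zero_apply]

/-- Rewriting happens only where two words are glued together. -/
theorem actWord_word_cons (hp : P.IsNormal u (p ++ [(a, b)])) :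
    P.actWord R v p (P.word R v ((a, c) :: l)) = P.word R v (p ++ (a, c) :: l) := by
  induction p with
  | nil => rfl
  | cons x p ih =>
    rw [actWord_cons, Module.End.mul_apply, ih hp.of_cons, act_word_of_not_clash]
    · rfl
    · have hclash := hp.2.2.1
      cases p <;> exact hclash

theorem actWord_word_nil (hp : P.IsNormal v p) :
    P.actWord R v p (P.word R v []) = P.word R v p := by
  rcases List.eq_nil_or_concat' p with rfl | ⟨p, ⟨a, b⟩, rfl⟩
  · rfl
  · rw [actWord_append, Module.End.mul_apply, actWord_cons, actWord_nil, mul_one,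
      act_word_of_not_clash not_clash_nil, actWord_word_cons hp]

end ActWord

section Degree

variable {R : Type*} [Ring R] {M : Type*} [AddCommGroup M] [Module R M]

/-- The maximal length of the words occurring in an element of the path module. -/
def degree (m : P.PathModule R v) : WithBot ℕ :=
  m.support.sup fun l => (l.1.length : WithBot ℕ)

variable (P R) in
/-- The coefficient of a word, which is zero if the word is not in normal form. -/
noncomputable def coeff (v : V) (t : List (N × N)) : P.PathModule R v →ₗ[R] R :=
  if h : P.IsNormal v t then Finsupp.lapply ⟨t, h⟩ else 0

theorem coeff_word {t : List (N × N)} :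
    P.coeff R v t (P.word R v l) = if l = t ∧ P.IsNormal v l then 1 else 0 := by
  by_cases hl : P.IsNormal v l
  · by_cases ht : P.IsNormal v t
    · simp [coeff, word, ht, hl, Finsupp.single_apply]
    · have hlt : l ≠ t := by
        rintro rfl
        exact ht hl
      simp [coeff, ht, hlt]
  · simp [word_of_not_isNormal hl, hl]

theorem coeff_word_of_isNormal {t : List (N × N)} (ht : P.IsNormal v t) :
    P.coeff R v t (P.word R v l) = if l = t then 1 else 0 := by
  rw [coeff_word]
  refine if_congr (and_iff_left_of_imp ?_) rfl rfl
  rintro rfl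
  exact ht

theorem isNormal_of_coeff_ne_zero {m : P.PathModule R v} (h : P.coeff R v l m ≠ 0) :
    P.IsNormal v l := by
  by_contra hl
  exact h (by simp [coeff, hl])

theorem coeff_proj (m : P.PathModule R v) :
    P.coeff R v l (P.proj R v u m) = if P.start v l = u then P.coeff R v l m else 0 := by
  have hhom : P.coeff R v l ∘ₗ P.proj R v u = if P.start v l = u then P.coeff R v l else 0 := by
    refine pathModule_hom_ext fun l' _ => ?_
    by_cases hll' : l' = l
    · subst hll'
      rw [LinearMap.comp_apply, proj_word]
      split_ifs <;> simp
    · rw [LinearMap.comp_apply, proj_word]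
      split_ifs <;> simp [coeff_word, hll']
  rw [← LinearMap.comp_apply, hhom]
  split_ifs <;> rfl

theorem start_eq_of_coeff_ne_zero {m : P.PathModule R v} (hm : P.proj R v u m = m)
    (h : P.coeff R v l m ≠ 0) : P.start v l = u := by
  by_contra hstart
  exact h (by rw [← hm, coeff_proj, if_neg hstart])

theorem degree_le_iff_mem_supported {m : P.PathModule R v} {k : WithBot ℕ} :
    degree m ≤ k ↔ m ∈ Finsupp.supported R R {l | (l.1.length : WithBot ℕ) ≤ k} :=
  Finset.sup_le_iff

theorem degree_eq_bot {m : P.PathModule R v} : degree m = ⊥ ↔ m = 0 := by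
  simp [degree, Finset.sup_eq_bot_iff, Finsupp.ext_iff]

theorem length_le_degree {m : P.PathModule R v} (h : P.coeff R v l m ≠ 0) :
    (l.length : WithBot ℕ) ≤ degree m := by
  have hl := isNormal_of_coeff_ne_zero h
  refine Finset.le_sup (f := fun l : {l // P.IsNormal v l} => (l.1.length : WithBot ℕ))
    (b := ⟨l, hl⟩) (Finsupp.mem_support_iff.2 ?_)
  simpa [coeff, hl] using h

theorem coeff_eq_zero_of_degree_lt {m : P.PathModule R v} (h : degree m < l.length) :
    P.coeff R v l m = 0 := by
  by_contra hl
  exact h.not_ge (length_le_degree hl)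

theorem exists_coeff_ne_zero {m : P.PathModule R v} (hm : m ≠ 0) :
    ∃ l, P.coeff R v l m ≠ 0 ∧ degree m = l.length := by
  obtain ⟨⟨l, hl⟩, hmem, hdeg⟩ := Finset.exists_mem_eq_sup m.support
    (Finsupp.support_nonempty_iff.2 hm) fun l => (l.1.length : WithBot ℕ)
  exact ⟨l, by simpa [coeff, hl] using hmem, hdeg⟩

theorem degree_word_le : degree (P.word R v l) ≤ l.length := by
  by_cases h : P.IsNormal v l
  · rw [degree_le_iff_mem_supported, word, dif_pos h]
    exact Finsupp.single_mem_supported R 1 (by simp)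
  · rw [word_of_not_isNormal h, degree_eq_bot.2 rfl]
    exact bot_le

theorem sum_coeff_smul_word (m : P.PathModule R v) :
    m.sum (fun l c => c • P.word R v l.1) = m := by
  conv_rhs => rw [← Finsupp.sum_single m]
  exact Finsupp.sum_congr fun l _ => by simp [word, l.2]

theorem degree_map_le (f : P.PathModule R u →ₗ[R] P.PathModule R v) {k : WithBot ℕ}
    (hf : ∀ l, P.IsNormal u l → degree (f (P.word R u l)) ≤ l.length + k)
    (m : P.PathModule R u) : degree (f m) ≤ degree m + k := by
  rw [degree_le_iff_mem_supported, ← sum_coeff_smul_word m, map_finsuppSum,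
    sum_coeff_smul_word]
  refine Submodule.sum_mem _ fun l hl => ?_
  simp only [map_smul]
  refine Submodule.smul_mem _ _ (degree_le_iff_mem_supported.1 ((hf l.1 l.2).trans ?_))
  gcongr
  exact Finset.le_sup (f := fun l : {l // P.IsNormal u l} => (l.1.length : WithBot ℕ)) hl

theorem map_eq_of_degree_le {f g : P.PathModule R v →ₗ[R] M} {m : P.PathModule R v}
    {k : ℕ} (hm : degree m ≤ k)
    (hfg : ∀ l, P.IsNormal v l → l.length ≤ k → f (P.word R v l) = g (P.word R v l)) :
    f m = g m := by
  rw [← sum_coeff_smul_word m, map_finsuppSum, map_finsuppSum]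
  refine Finsupp.sum_congr fun l hl => ?_
  rw [map_smul, map_smul, hfg l.1 l.2]
  exact WithBot.coe_le_coe.1 ((Finset.sup_le_iff.1 hm) l hl)

theorem eq_smul_word_nil {m : P.PathModule R v} (hm : degree m ≤ 0) :
    m = P.coeff R v [] m • P.word R v [] := by
  refine map_eq_of_degree_le (f := LinearMap.id)
    (g := (P.coeff R v []).smulRight (P.word R v [])) (k := 0) hm fun l hl hlen => ?_
  obtain rfl := List.eq_nil_of_length_eq_zero (Nat.le_zero.1 hlen)
  simp [coeff_word, hl]

theorem degree_act_le (m : P.PathModule R v) : degree (P.act R v a b m) ≤ degree m + 1 := by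
  refine degree_map_le _ (fun l hl => ?_) m
  by_cases hc : P.Clash a b l
  · obtain ⟨rfl, c, l, rfl⟩ := exists_of_clash hc
    rw [act_pivot_word hl, degree_le_iff_mem_supported]
    refine Submodule.sub_mem _ ?_ (Submodule.sum_mem _ fun e _ => ?_)
    · split_ifs
      · refine degree_le_iff_mem_supported.1 (degree_word_le.trans ?_)
        norm_cast
        simp only [List.length_cons]
        omega
      · exact zero_mem _
    · exact degree_le_iff_mem_supported.1 degree_word_le
  · rw [act_word_of_not_clash hc]
    exact degree_word_le

theorem degree_actWord_le (m : P.PathModule R v) :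
    degree (P.actWord R v p m) ≤ p.length + degree m := by
  induction p with
  | nil => simp [actWord_nil]
  | cons x p ih =>
    rw [actWord_cons, Module.End.mul_apply]
    calc degree (P.act R v x.1 x.2 (P.actWord R v p m))
        ≤ degree (P.actWord R v p m) + 1 := degree_act_le _
      _ ≤ p.length + degree m + 1 := by gcongr
      _ = (x :: p).length + degree m := by
        rw [List.length_cons, Nat.cast_succ]
        ac_rfl

theorem degree_mulRight_le (n : P.PathModule R u) (m : P.PathModule R v) :
    degree (P.mulRight R u m n) ≤ degree n + degree m :=
  degree_map_le _ (fun p hp => by rw [mulRight_word hp]; exact degree_actWord_le m) n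

end Degree

section LeadingTerms

variable {R : Type*} [Ring R]

theorem append_cons_cons_inj {p' q' : List (N × N)} {x y x' y' : N × N}
    (hp : p'.length = p.length) :
    p' ++ x' :: y' :: q' = p ++ x :: y :: q ↔ p' = p ∧ x' = x ∧ y' = y ∧ q' = q := by
  refine ⟨fun h => ?_, by rintro ⟨rfl, rfl, rfl, rfl⟩; rfl⟩
  simpa using List.append_inj h hp

theorem length_append_cons_cons {x y : N × N} :
    (p ++ x :: y :: q).length = p.length + q.length + 2 := by
  simp only [List.length_append, List.length_cons]
  omega

theorem coeff_actWord_act_pivot {p' q' : List (N × N)} {a' d' : N}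
    (hp' : P.IsNormal u (p' ++ [(a', P.pivot a')])) (hq' : P.IsNormal v ((P.pivot a', d') :: q'))
    (hp : p'.length = p.length) (hq : q'.length = q.length)
    (ht : P.IsNormal v (p ++ (a, b) :: (c, d) :: q)) :
    P.coeff R v (p ++ (a, b) :: (c, d) :: q)
        (P.actWord R v p' (P.act R v a' (P.pivot a') (P.word R v ((P.pivot a', d') :: q')))) =
      if p' = p ∧ a' = a ∧ b = c ∧ d' = d ∧ q' = q then -1 else 0 := by
  have hshort : P.coeff R v (p ++ (a, b) :: (c, d) :: q)
      (P.actWord R v p' (if a' = d' then P.word R v q' else 0)) = 0 := by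
    split_ifs
    · refine coeff_eq_zero_of_degree_lt ((degree_actWord_le _).trans_lt ?_)
      refine (add_le_add_right degree_word_le _).trans_lt ?_
      norm_cast
      simp only [List.length_append, List.length_cons]
      omega
    · rw [map_zero, map_zero]
  rw [act_pivot_word hq', map_sub, map_sub, map_sum, map_sum, hshort, zero_sub]
  simp only [actWord_word_cons hp', coeff_word_of_isNormal ht, append_cons_cons_inj hp,
    Prod.mk.injEq]
  by_cases heq : p' = p ∧ a' = a ∧ b = c ∧ d' = d ∧ q' = q
  · obtain ⟨rfl, rfl, rfl, rfl, rfl⟩ := heq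
    obtain ⟨hb, -, hnotClash, -⟩ := isNormal_cons.1 ht.of_append
    have hb : b ∈ (P.nbr a').erase (P.pivot a') :=
      Finset.mem_erase.2 ⟨fun h => hnotClash (clash_cons.2 ⟨h, rfl⟩), hb⟩
    simp [hb]
  · rw [if_neg heq, Finset.sum_eq_zero, neg_zero]
    refine fun e _ => if_neg ?_
    rintro ⟨rfl, ⟨rfl, rfl⟩, ⟨rfl, rfl⟩, rfl⟩
    exact heq ⟨rfl, rfl, rfl, rfl, rfl⟩

theorem coeff_actWord_word {p' q' : List (N × N)} (hp' : P.IsNormal u p') (hq' : P.IsNormal v q')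
    (hp : p'.length = p.length + 1) (hq : q'.length = q.length + 1)
    (ht : P.IsNormal v (p ++ (a, b) :: (c, d) :: q)) :
    P.coeff R v (p ++ (a, b) :: (c, d) :: q) (P.actWord R v p' (P.word R v q')) =
      (if p' = p ++ [(a, b)] ∧ q' = (c, d) :: q then 1 else 0) -
        if b = c ∧ p' = p ++ [(a, P.pivot a)] ∧ q' = (P.pivot a, d) :: q then 1 else 0 := by
  obtain ⟨p', ⟨a', b'⟩, rfl⟩ := (List.eq_nil_or_concat' p').resolve_left (by rintro rfl; simp at hp)
  obtain ⟨⟨c', d'⟩, q', rfl⟩ := List.exists_cons_of_ne_nil (l := q') (by rintro rfl; simp at hq)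
  have hlength : p'.length = p.length := by simpa using hp
  have hconcat (e : N) : p' ++ [(a', b')] = p ++ [(a, e)] ↔ p' = p ∧ a' = a ∧ b' = e := by
    simp [← List.concat_eq_append, List.concat_inj]
  have hnotClash := (isNormal_cons.1 ht.of_append).2.2.1
  rw [clash_cons] at hnotClash
  rw [actWord_append, Module.End.mul_apply, actWord_cons, actWord_nil, mul_one]
  by_cases hclash : P.Clash a' b' ((c', d') :: q')
  · obtain ⟨rfl, rfl⟩ := clash_cons.1 hclash
    rw [coeff_actWord_act_pivot hp' hq' hlength (Nat.succ_injective hq) ht]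
    simp only [hconcat, List.cons.injEq, Prod.mk.injEq]
    grind
  · rw [act_word_of_not_clash hclash, actWord_word_cons hp', coeff_word_of_isNormal ht]
    simp only [append_cons_cons_inj hlength, hconcat, List.cons.injEq, Prod.mk.injEq]
    rw [clash_cons] at hclash
    grind

theorem coeff_actWord {p' : List (N × N)} {m : P.PathModule R v} (hp' : P.IsNormal u p')
    (hp : p'.length ≤ p.length + 1) (hm : degree m ≤ (q.length + 1 : ℕ))
    (ht : P.IsNormal v (p ++ (a, b) :: (c, d) :: q)) :
    P.coeff R v (p ++ (a, b) :: (c, d) :: q) (P.actWord R v p' m) =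
      (if p' = p ++ [(a, b)] then P.coeff R v ((c, d) :: q) m else 0) -
        if b = c ∧ p' = p ++ [(a, P.pivot a)] then P.coeff R v ((P.pivot a, d) :: q) m else 0 := by
  refine (map_eq_of_degree_le hm
    (f := P.coeff R v (p ++ (a, b) :: (c, d) :: q) ∘ₗ P.actWord R v p')
    (g := (if p' = p ++ [(a, b)] then P.coeff R v ((c, d) :: q) else 0) -
      if b = c ∧ p' = p ++ [(a, P.pivot a)] then P.coeff R v ((P.pivot a, d) :: q) else 0)
    fun q' hq' hq => ?_).trans (by split_ifs <;> simp)
  rw [LinearMap.comp_apply]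
  by_cases hmax : p'.length = p.length + 1 ∧ q'.length = q.length + 1
  · rw [coeff_actWord_word hp' hq' hmax.1 hmax.2 ht]
    split_ifs <;> simp only [LinearMap.sub_apply, LinearMap.zero_apply, coeff_word] <;> grind
  · rw [coeff_eq_zero_of_degree_lt]
    · split_ifs <;> simp only [LinearMap.sub_apply, LinearMap.zero_apply, coeff_word] <;> grind
    · refine (degree_actWord_le _).trans_lt ((add_le_add_right degree_word_le _).trans_lt ?_)
      norm_cast
      simp only [List.length_append, List.length_cons]
      omega

theorem coeff_mulRight {n : P.PathModule R u} {m : P.PathModule R v}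
    (hn : degree n ≤ (p.length + 1 : ℕ)) (hm : degree m ≤ (q.length + 1 : ℕ))
    (ht : P.IsNormal v (p ++ (a, b) :: (c, d) :: q)) :
    P.coeff R v (p ++ (a, b) :: (c, d) :: q) (P.mulRight R u m n) =
      P.coeff R u (p ++ [(a, b)]) n * P.coeff R v ((c, d) :: q) m -
        if b = c then
          P.coeff R u (p ++ [(a, P.pivot a)]) n * P.coeff R v ((P.pivot a, d) :: q) m
        else 0 := by
  refine (map_eq_of_degree_le hn
    (f := P.coeff R v (p ++ (a, b) :: (c, d) :: q) ∘ₗ P.mulRight R u m)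
    (g := (P.coeff R u (p ++ [(a, b)])).smulRight (P.coeff R v ((c, d) :: q) m) -
      if b = c then
        (P.coeff R u (p ++ [(a, P.pivot a)])).smulRight (P.coeff R v ((P.pivot a, d) :: q) m)
      else 0) fun p' hp' hp => ?_).trans (by split_ifs <;> simp)
  rw [LinearMap.comp_apply, mulRight_word hp', coeff_actWord hp' hp hm ht]
  split_ifs <;> simp_all [coeff_word]

theorem coeff_mulRight_smul_word_nil (n : P.PathModule R v) (r : R) :
    P.coeff R v p (P.mulRight R v (r • P.word R v []) n) = P.coeff R v p n * r := by
  have hhom : P.coeff R v p ∘ₗ P.mulRight R v (r • P.word R v []) =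
      (P.coeff R v p).smulRight r := by
    refine pathModule_hom_ext fun l hl => ?_
    rw [LinearMap.comp_apply, mulRight_word hl, map_smul, actWord_word_nil hl]
    by_cases hlp : l = p <;> simp [coeff_word, hl, hlp]
  exact LinearMap.congr_fun hhom n

/-- Any two nodes with a common neighbour `b` also have a common neighbour other than the pivot. -/
def IsBranching (P : PivotedGraph V N) : Prop :=
  ∀ ⦃a b c⦄, b ∈ P.nbr a → c ∈ P.nbr b → ∃ d, d ≠ P.pivot a ∧ d ∈ P.nbr a ∧ d ∈ P.nbr c

theorem exists_coeff_mulRight_ne_zero_of_ne [NoZeroDivisors R]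
    {n : P.PathModule R u} {m : P.PathModule R v}
    (hn : degree n ≤ (p.length + 1 : ℕ)) (hm : degree m ≤ (q.length + 1 : ℕ))
    (hnp : P.coeff R u (p ++ [(a, b)]) n ≠ 0) (hmq : P.coeff R v ((c, d) :: q) m ≠ 0)
    (hc : P.base c = u) (hbc : b ≠ c) :
    ∃ t, P.coeff R v t (P.mulRight R u m n) ≠ 0 ∧ t.length = p.length + q.length + 2 := by
  have hp := isNormal_of_coeff_ne_zero hnp
  have ht : P.IsNormal v (p ++ (a, b) :: (c, d) :: q) :=
    hp.append_cons ⟨hp.last_mem_nbr, hp.base_eq.trans hc.symm,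
      fun h => hbc (clash_cons.1 h).2.symm, isNormal_of_coeff_ne_zero hmq⟩
  refine ⟨p ++ (a, b) :: (c, d) :: q, ?_, length_append_cons_cons⟩
  rw [coeff_mulRight hn hm ht, if_neg hbc, sub_zero]
  exact mul_ne_zero hnp hmq

/-- If all the top coefficients of the product vanished, top words of the factors could only meet
in a common node. Passing from this node to another common neighbour would then yield a top word of
the left factor that meets the top word of the right factor in two distinct nodes. -/
theorem exists_coeff_mulRight_ne_zero [NoZeroDivisors R] (hP : P.IsBranching)
    {n : P.PathModule R u} {m : P.PathModule R v}
    (hn : degree n ≤ (p.length + 1 : ℕ)) (hm : degree m ≤ (q.length + 1 : ℕ))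
    (hnp : P.coeff R u (p ++ [(a, b)]) n ≠ 0) (hmq : P.coeff R v ((c, d) :: q) m ≠ 0)
    (hc : P.base c = u) :
    ∃ t, P.coeff R v t (P.mulRight R u m n) ≠ 0 ∧ t.length = p.length + q.length + 2 := by
  by_contra! hzero
  have hmeet {b : N} (hnp : P.coeff R u (p ++ [(a, b)]) n ≠ 0) : b = c := by
    by_contra hbc
    obtain ⟨t, ht, hlength⟩ := exists_coeff_mulRight_ne_zero_of_ne hn hm hnp hmq hc hbc
    exact hzero t ht hlength
  obtain rfl := hmeet hnp
  have hp := isNormal_of_coeff_ne_zero hnp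
  have hq := isNormal_of_coeff_ne_zero hmq
  have hvanish {e : N} (hea : e ∈ P.nbr a) (hed : d ∈ P.nbr e) (he : e ≠ P.pivot a) :
      P.coeff R u (p ++ [(a, e)]) n * P.coeff R v ((e, d) :: q) m =
        P.coeff R u (p ++ [(a, P.pivot a)]) n * P.coeff R v ((P.pivot a, d) :: q) m := by
    have ht : P.IsNormal v (p ++ (a, e) :: (e, d) :: q) :=
      hp.append_cons ⟨hea, rfl, fun h => he (clash_cons.1 h).1, hq.congr_left hed⟩
    have hcoeff := coeff_mulRight hn hm ht
    rw [if_pos rfl] at hcoeff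
    rw [← sub_eq_zero, ← hcoeff]
    by_contra h
    exact hzero _ h length_append_cons_cons
  by_cases hb : b = P.pivot a
  · obtain ⟨e, he, hea, hed⟩ := hP hp.last_mem_nbr hq.1
    have hprod := hvanish hea (P.mem_nbr_symm hed) he
    rw [← hb] at hprod
    have hne := hprod.trans_ne (mul_ne_zero hnp hmq)
    exact he ((hmeet (left_ne_zero_of_mul hne)).trans hb)
  · have hprod := hvanish hp.last_mem_nbr hq.1 hb
    have hne := hprod.symm.trans_ne (mul_ne_zero hnp hmq)
    exact hb (hmeet (left_ne_zero_of_mul hne)).symm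

theorem degree_mulRight [NoZeroDivisors R] (hP : P.IsBranching) (n : P.PathModule R u)
    {m : P.PathModule R v} (hm : P.proj R v u m = m) :
    degree (P.mulRight R u m n) = degree n + degree m := by
  rcases eq_or_ne n 0 with rfl | hn
  · rw [map_zero, degree_eq_bot.2 rfl, degree_eq_bot.2 rfl, WithBot.bot_add]
  rcases eq_or_ne m 0 with rfl | hm₀
  · rw [mulRight_zero, LinearMap.zero_apply, degree_eq_bot.2 rfl, WithBot.add_bot]
  refine (degree_mulRight_le n m).antisymm ?_
  obtain ⟨p, hnp, hp⟩ := exists_coeff_ne_zero hn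
  obtain ⟨q, hmq, hq⟩ := exists_coeff_ne_zero hm₀
  have hstart := start_eq_of_coeff_ne_zero hm hmq
  suffices ∃ t, P.coeff R v t (P.mulRight R u m n) ≠ 0 ∧ t.length = p.length + q.length by
    obtain ⟨t, ht, hlength⟩ := this
    rw [hp, hq, ← Nat.cast_add, ← hlength]
    exact length_le_degree ht
  rcases List.eq_nil_or_concat' p with rfl | ⟨p, ⟨a, b⟩, rfl⟩
  · refine ⟨q, ?_, by simp⟩
    rw [eq_smul_word_nil hp.le, map_smul, mulRight_word isNormal_nil, actWord_nil]
    simpa [coeff_word, IsNormal] using ⟨hnp, hmq⟩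
  · rcases q with _ | ⟨⟨c, d⟩, q⟩
    · obtain rfl : v = u := hstart
      refine ⟨p ++ [(a, b)], ?_, rfl⟩
      rw [eq_smul_word_nil hq.le, coeff_mulRight_smul_word_nil]
      exact mul_ne_zero hnp hmq
    · refine (exists_coeff_mulRight_ne_zero hP (by simpa using hp.le) hq.le hnp hmq hstart).imp
        fun t ht => ⟨ht.1, ht.2.trans ?_⟩
      simp only [List.length_append, List.length_cons, List.length_nil]
      omega

end LeadingTerms

section Families

/-- Elements of a ring satisfying the relations between the vertices and the arrows of the graph.
For the graph `WeightedGraph.bipartite`, these are the relations of the weighted Leavitt path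
algebra. -/
structure LeavittFamily (P : PivotedGraph V N) (A : Type*) [NonUnitalRing A] where
  vtx : V → A
  arrow : N → N → A
  vtx_mul_self : ∀ u, vtx u * vtx u = vtx u
  vtx_mul_of_ne : ∀ {u w}, u ≠ w → vtx u * vtx w = 0
  arrow_eq_zero : ∀ {a b}, b ∉ P.nbr a → arrow a b = 0
  vtx_mul_arrow : ∀ a b, vtx (P.base a) * arrow a b = arrow a b
  arrow_mul_vtx : ∀ a b, arrow a b * vtx (P.base b) = arrow a b
  sum_arrow_mul_arrow : ∀ {a} c, (P.nbr a).Nonempty →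
    ∑ b ∈ P.nbr a, arrow a b * arrow b c = if a = c then vtx (P.base a) else 0

/-- The vertices and arrows as operators on the path module. -/
noncomputable def regularFamily (P : PivotedGraph V N) (R : Type*) [Ring R] (v : V) :
    P.LeavittFamily (Module.End R (P.PathModule R v)) where
  vtx := P.proj R v
  arrow := P.act R v
  vtx_mul_self := proj_mul_self
  vtx_mul_of_ne := proj_mul_of_ne
  arrow_eq_zero := act_eq_zero
  vtx_mul_arrow _ _ := proj_mul_act
  arrow_mul_vtx _ _ := act_mul_proj
  sum_arrow_mul_arrow _ := sum_act_mul_act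

namespace LeavittFamily

variable {A : Type*} [NonUnitalRing A] (F : P.LeavittFamily A)

/-- The image of a family under a ring homomorphism. -/
def map {B : Type*} [NonUnitalRing B] (f : A →ₙ+* B) : P.LeavittFamily B where
  vtx u := f (F.vtx u)
  arrow a b := f (F.arrow a b)
  vtx_mul_self u := by rw [← map_mul, F.vtx_mul_self]
  vtx_mul_of_ne h := by rw [← map_mul, F.vtx_mul_of_ne h, map_zero]
  arrow_eq_zero h := by rw [F.arrow_eq_zero h, map_zero]
  vtx_mul_arrow a b := by rw [← map_mul, F.vtx_mul_arrow]
  arrow_mul_vtx a b := by rw [← map_mul, F.arrow_mul_vtx]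
  sum_arrow_mul_arrow c ha := by
    simp only [← map_mul, ← map_sum, F.sum_arrow_mul_arrow c ha, apply_ite f, map_zero]

/-- The product of the arrows of a word that ends at `v`. -/
def wordProd (v : V) : List (N × N) → A
  | [] => F.vtx v
  | x :: l => F.arrow x.1 x.2 * wordProd v l

theorem vtx_mul_wordProd (l : List (N × N)) :
    F.vtx (P.start v l) * F.wordProd v l = F.wordProd v l := by
  cases l with
  | nil => exact F.vtx_mul_self v
  | cons x l => rw [wordProd, ← mul_assoc, start, F.vtx_mul_arrow]

theorem vtx_mul_wordProd_of_ne (h : u ≠ P.start v l) : F.vtx u * F.wordProd v l = 0 := by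
  rw [← vtx_mul_wordProd, ← mul_assoc, F.vtx_mul_of_ne h, zero_mul]

theorem arrow_mul_wordProd_of_ne (h : P.base b ≠ P.start v l) :
    F.arrow a b * F.wordProd v l = 0 := by
  rw [← F.arrow_mul_vtx, mul_assoc, vtx_mul_wordProd_of_ne F h, mul_zero]

theorem arrow_mul_arrow_of_ne (h : P.base b ≠ P.base c) : F.arrow a b * F.arrow c d = 0 := by
  rw [← F.arrow_mul_vtx, ← F.vtx_mul_arrow c, mul_assoc, ← mul_assoc (F.vtx _),
    F.vtx_mul_of_ne h, zero_mul, mul_zero]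

theorem sum_mul_vtx {x : A} (hx : x * F.vtx u = x) {t : Finset V} (hu : u ∈ t) :
    ∑ w ∈ t, x * F.vtx w = x := by
  rw [Finset.sum_eq_single_of_mem u hu fun w _ hw => ?_, hx]
  rw [← hx, mul_assoc, F.vtx_mul_of_ne hw.symm, mul_zero]

variable (R : Type*) [Ring R] [Module R A]

/-- The linear map that multiplies out the words of the path module. -/
noncomputable def eval (v : V) : P.PathModule R v →ₗ[R] A :=
  Finsupp.linearCombination R fun l => F.wordProd v l.1

variable {R}

theorem eval_word (h : P.IsNormal v l) : F.eval R v (P.word R v l) = F.wordProd v l :=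
  linearCombination_word (f := F.wordProd v) h

theorem eval_word_cons (hc : ¬P.Clash a b l) (hl : P.IsNormal v l) :
    F.eval R v (P.word R v ((a, b) :: l)) = F.arrow a b * F.wordProd v l := by
  by_cases h : P.IsNormal v ((a, b) :: l)
  · exact F.eval_word h
  · rw [word_of_not_isNormal h, map_zero]
    by_cases hb : b ∈ P.nbr a
    · exact (F.arrow_mul_wordProd_of_ne fun hstart => h ⟨hb, hstart, hc, hl⟩).symm
    · rw [F.arrow_eq_zero hb, zero_mul]

theorem arrow_pivot_mul_arrow (ha : P.pivot a ∈ P.nbr a) :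
    F.arrow a (P.pivot a) * F.arrow (P.pivot a) c =
      (if a = c then F.vtx (P.base a) else 0) -
        ∑ e ∈ (P.nbr a).erase (P.pivot a), F.arrow a e * F.arrow e c := by
  rw [← F.sum_arrow_mul_arrow c ⟨_, ha⟩, ← Finset.add_sum_erase _ _ ha, add_sub_cancel_right]

theorem eval_act_word (hl : P.IsNormal v l) :
    F.eval R v (P.act R v a b (P.word R v l)) = F.arrow a b * F.wordProd v l := by
  by_cases hc : P.Clash a b l
  · obtain ⟨rfl, c, l, rfl⟩ := exists_of_clash hc
    obtain ⟨-, hstart, -, hl'⟩ := isNormal_cons.1 hl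
    by_cases ha : P.pivot a ∈ P.nbr a
    · have heval : ∀ e ∈ (P.nbr a).erase (P.pivot a),
          F.eval R v (P.word R v ((a, e) :: (e, c) :: l)) =
            F.arrow a e * F.arrow e c * F.wordProd v l := by
        intro e he
        by_cases hce : c ∈ P.nbr e
        · rw [F.eval_word_cons (fun h => Finset.ne_of_mem_erase he h.1) (hl.congr_left hce),
            mul_assoc, wordProd]
        · rw [word_of_not_isNormal fun h => hce (isNormal_cons.1 h.of_cons).1, map_zero,
            F.arrow_eq_zero hce, mul_zero, zero_mul]
      have hvtx : F.eval R v (if a = c then P.word R v l else 0) =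
          (if a = c then F.vtx (P.base a) else 0) * F.wordProd v l := by
        split_ifs with hac
        · rw [hac, hstart, F.vtx_mul_wordProd, F.eval_word hl']
        · rw [map_zero, zero_mul]
      rw [act_pivot_word hl, map_sub, map_sum, Finset.sum_congr rfl heval, hvtx, wordProd,
        ← mul_assoc, F.arrow_pivot_mul_arrow ha, sub_mul, Finset.sum_mul]
    · rw [act_eq_zero ha, F.arrow_eq_zero ha, LinearMap.zero_apply, map_zero, zero_mul]
  · rw [act_word_of_not_clash hc, F.eval_word_cons hc hl]

theorem eval_act (hF : ∀ a b (r : R) x, F.arrow a b * r • x = r • (F.arrow a b * x))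
    (m : P.PathModule R v) : F.eval R v (P.act R v a b m) = F.arrow a b * F.eval R v m := by
  let mulArrow : A →ₗ[R] A :=
    { toFun := (F.arrow a b * ·), map_add' := mul_add _, map_smul' := hF a b }
  have hhom : F.eval R v ∘ₗ P.act R v a b = mulArrow ∘ₗ F.eval R v :=
    pathModule_hom_ext fun l hl => by
      rw [LinearMap.comp_apply, eval_act_word F hl, LinearMap.comp_apply, F.eval_word hl]
      rfl
  exact LinearMap.congr_fun hhom m

theorem eval_proj (hF : ∀ u (r : R) x, F.vtx u * r • x = r • (F.vtx u * x))
    (m : P.PathModule R v) : F.eval R v (P.proj R v u m) = F.vtx u * F.eval R v m := by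
  let mulVtx : A →ₗ[R] A :=
    { toFun := (F.vtx u * ·), map_add' := mul_add _, map_smul' := hF u }
  have hhom : F.eval R v ∘ₗ P.proj R v u = mulVtx ∘ₗ F.eval R v :=
    pathModule_hom_ext fun l hl => by
      rw [LinearMap.comp_apply, proj_word, LinearMap.comp_apply, F.eval_word hl]
      change _ = F.vtx u * F.wordProd v l
      split_ifs with hu
      · rw [← hu, F.vtx_mul_wordProd, F.eval_word hl]
      · rw [map_zero, F.vtx_mul_wordProd_of_ne (Ne.symm hu)]
  exact LinearMap.congr_fun hhom m

end LeavittFamily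

end Families

section LeftQuasiregular

variable {R : Type*} [Ring R]

theorem degree_add_le (n m : P.PathModule R v) : degree (n + m) ≤ max (degree n) (degree m) :=
  degree_le_iff_mem_supported.2 <| add_mem
    (degree_le_iff_mem_supported.1 (le_max_left _ _))
    (degree_le_iff_mem_supported.1 (le_max_right _ _))

theorem mulRight_smul_word_nil (m : P.PathModule R v) (r : R) :
    P.mulRight R u m (r • P.word R u []) = r • m := by
  rw [map_smul, mulRight_word isNormal_nil, actWord_nil, Module.End.one_apply]

theorem add_ne_mulRight_of_one_le_degree [NoZeroDivisors R] (hP : P.IsBranching)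
    {m : P.PathModule R v} (hm : P.proj R v v m = m) (hdeg : 1 ≤ degree m)
    (n : P.PathModule R v) : n + m ≠ P.mulRight R v m n := by
  intro h
  have hm₀ : m ≠ 0 := by
    rintro rfl
    simp [degree_eq_bot.2 rfl] at hdeg
  obtain ⟨l, hl, hml⟩ := exists_coeff_ne_zero hm₀
  rw [hml] at hdeg
  have hn : degree n ≤ 0 := by
    rcases eq_or_ne n 0 with rfl | hn₀
    · rw [degree_eq_bot.2 rfl]
      exact bot_le
    · obtain ⟨p, -, hnp⟩ := exists_coeff_ne_zero hn₀
      have hle := degree_add_le n m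
      rw [h, degree_mulRight hP n hm, hml, hnp, le_max_iff] at hle
      rw [hnp]
      norm_cast at hle hdeg ⊢
      omega
  obtain ⟨r, rfl⟩ : ∃ r : R, n = r • P.word R v [] := ⟨_, eq_smul_word_nil hn⟩
  rw [mulRight_smul_word_nil] at h
  have hcoeff : P.coeff R v l m = r * P.coeff R v l m := by
    have hl₀ : [] ≠ l := by
      rintro rfl
      norm_num at hdeg
    simpa [coeff_word, hl₀] using congrArg (P.coeff R v l) h
  have hr : r = 1 := by
    rw [← sub_eq_zero]
    exact (mul_eq_zero.1 (by rw [sub_mul, one_mul, ← hcoeff, sub_self])).resolve_right hl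
  rw [hr, one_smul, one_smul, add_eq_right] at h
  have hone : (1 : R) = 0 := by
    simpa [coeff_word, isNormal_nil] using congrArg (P.coeff R v []) h
  exact hl (by rw [hcoeff, hr, hone, zero_mul])

theorem degree_act [NoZeroDivisors R] (hP : P.IsBranching) (hb : b ∈ P.nbr a)
    {m : P.PathModule R v} (hm : P.proj R v (P.base b) m = m) :
    degree (P.act R v a b m) = 1 + degree m := by
  rcases subsingleton_or_nontrivial R with _ | _
  · have := Module.subsingleton R (P.PathModule R v)
    rw [degree_eq_bot.2 (Subsingleton.elim _ 0), degree_eq_bot.2 (Subsingleton.elim m 0),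
      WithBot.add_bot]
  have hab : P.IsNormal (P.base b) [(a, b)] := ⟨hb, rfl, not_clash_nil, trivial⟩
  have hdeg : degree (P.word R (P.base b) [(a, b)]) = 1 := by
    refine degree_word_le.antisymm (length_le_degree (l := [(a, b)]) ?_)
    simp [coeff_word, hab]
  rw [← hdeg, ← degree_mulRight hP _ hm, mulRight_word hab, actWord_cons, actWord_nil, mul_one]

theorem proj_act (m : P.PathModule R v) :
    P.proj R v (P.base a) (P.act R v a b m) = P.act R v a b m := by
  rw [← Module.End.mul_apply, proj_mul_act]

/-- The word `p` walks back along `l`. -/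
theorem exists_actWord_of_isNormal [NoZeroDivisors R] (hP : P.IsBranching)
    (hl : P.IsNormal w l) {m : P.PathModule R v} (hm : P.proj R v (P.start w l) m = m) :
    ∃ p, P.proj R v w (P.actWord R v p m) = P.actWord R v p m ∧
      degree m ≤ degree (P.actWord R v p m) := by
  induction l generalizing m with
  | nil => exact ⟨[], hm, le_rfl⟩
  | cons x l ih =>
    obtain ⟨a, b⟩ := x
    obtain ⟨hb, hstart, -, hl'⟩ := isNormal_cons.1 hl
    obtain ⟨p, hp, hdeg⟩ := ih hl' (m := P.act R v b a m) (hstart ▸ proj_act m)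
    refine ⟨p ++ [(b, a)], ?_⟩
    rw [actWord_append, Module.End.mul_apply, actWord_cons, actWord_nil, mul_one]
    refine ⟨hp, le_trans ?_ hdeg⟩
    rw [degree_act hP (P.mem_nbr_symm hb) hm]
    exact le_add_of_nonneg_left zero_le_one

theorem exists_actWord_one_le_degree [NoZeroDivisors R] (hP : P.IsBranching)
    (hv : ∃ a b, b ∈ P.nbr a ∧ P.base a = v) {m : P.PathModule R v} (hm : m ≠ 0) :
    ∃ u p, P.proj R v v (P.actWord R v p (P.proj R v u m)) = P.actWord R v p (P.proj R v u m) ∧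
      1 ≤ degree (P.actWord R v p (P.proj R v u m)) := by
  obtain ⟨a, b, hb, rfl⟩ := hv
  obtain ⟨l, hl, -⟩ := exists_coeff_ne_zero hm
  have hproj : P.proj R _ (P.start (P.base a) l) m ≠ 0 := by
    intro h
    apply hl
    rw [← map_zero (P.coeff R _ l), ← h, coeff_proj, if_pos rfl]
  obtain ⟨l', -, hl'⟩ := exists_coeff_ne_zero hproj
  obtain ⟨p, hp, hdeg⟩ := exists_actWord_of_isNormal hP (isNormal_of_coeff_ne_zero hl)
    (m := P.proj R _ (P.start (P.base a) l) m) (by rw [← Module.End.mul_apply, proj_mul_self])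
  refine ⟨P.start (P.base a) l, (a, b) :: (b, a) :: p, ?_⟩
  rw [actWord_cons, actWord_cons, Module.End.mul_apply, Module.End.mul_apply]
  refine ⟨proj_act _, ?_⟩
  rw [degree_act hP hb (proj_act _), degree_act hP (P.mem_nbr_symm hb) hp]
  rw [hl'] at hdeg
  exact le_add_of_nonneg_right (add_nonneg zero_le_one ((Nat.cast_nonneg _).trans hdeg))

end LeftQuasiregular

end PivotedGraph

namespace WeightedGraph

open PivotedGraph Filter

open Sum (inl inr)

variable {V S : Type*} {E : WeightedGraph V S} {R : Type*} [Ring R]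

section LeavittPathAlgebra

variable (E R) in
/-- The quotient map from `R⟨X⟩` onto the weighted Leavitt path algebra. -/
noncomputable def toLeavitt : E.FreeRRing R →ₙ+* E.LeavittPathAlgebra R where
  toFun f := f
  map_zero' := rfl
  map_add' _ _ := rfl
  map_mul' _ _ := rfl

theorem toLeavitt_surjective : Function.Surjective (E.toLeavitt R) := Quotient.mk_surjective

theorem toLeavitt_eq_iff {f g : E.FreeRRing R} :
    E.toLeavitt R f = E.toLeavitt R g ↔ f - g ∈ E.relIdeal R :=
  (RingCon.eq _).trans (TwoSidedIdeal.rel_iff _ _ _)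

theorem toLeavitt_eq_of_rel {f g : E.FreeRRing R} (h : E.Rel R f g) :
    E.toLeavitt R f = E.toLeavitt R g := by
  rw [toLeavitt_eq_iff, relIdeal, TwoSidedIdeal.mem_sInf]
  exact fun I hI => hI.1 _ _ h

theorem toLeavitt_smul_congr (r : R) {f g : E.FreeRRing R} (h : E.toLeavitt R f = E.toLeavitt R g) :
    E.toLeavitt R (r • f) = E.toLeavitt R (r • g) := by
  rw [toLeavitt_eq_iff, relIdeal, TwoSidedIdeal.mem_sInf] at h ⊢
  rw [← smul_sub]
  exact fun I hI => (hI.2 r _ (h I hI)).1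

noncomputable instance : SMul R (E.LeavittPathAlgebra R) where
  smul r := Quotient.lift (fun f => E.toLeavitt R (r • f)) fun _ _ h =>
    toLeavitt_smul_congr r (Quotient.sound h)

theorem toLeavitt_smul (r : R) (f : E.FreeRRing R) :
    E.toLeavitt R (r • f) = r • E.toLeavitt R f :=
  rfl

noncomputable instance : Module R (E.LeavittPathAlgebra R) :=
  toLeavitt_surjective.module R (E.toLeavitt R : E.FreeRRing R →+ E.LeavittPathAlgebra R)
    toLeavitt_smul

theorem smul_mul (r : R) (x y : E.LeavittPathAlgebra R) : r • x * y = r • (x * y) := by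
  obtain ⟨f, rfl⟩ := toLeavitt_surjective x
  obtain ⟨g, rfl⟩ := toLeavitt_surjective y
  rw [← toLeavitt_smul, ← map_mul, ← map_mul, ← toLeavitt_smul, smul_mul_assoc]

theorem toLeavitt_ι_mul_smul (x : E.Gen) (r : R) (y : E.LeavittPathAlgebra R) :
    E.toLeavitt R (E.ι R x) * r • y = r • (E.toLeavitt R (E.ι R x) * y) := by
  obtain ⟨f, rfl⟩ := toLeavitt_surjective y
  rw [← toLeavitt_smul, ← map_mul, ← map_mul, ← toLeavitt_smul]
  congr 1
  induction f using MonoidAlgebra.induction_linear with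
  | zero => simp
  | add f g hf hg => rw [smul_add, mul_add, hf, hg, mul_add, smul_add]
  | single w s => simp [ι, MonoidAlgebra.single_mul_single]

theorem leavitt_induction {p : E.LeavittPathAlgebra R → Prop}
    (gen : ∀ x, p (E.toLeavitt R (E.ι R x))) (zero : p 0) (add : ∀ x y, p x → p y → p (x + y))
    (mul : ∀ x y, p x → p y → p (x * y)) (smul : ∀ (r : R) x, p x → p (r • x))
    (x : E.LeavittPathAlgebra R) : p x := by
  obtain ⟨f, rfl⟩ := toLeavitt_surjective x
  induction f using MonoidAlgebra.induction_linear with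
  | zero => exact zero
  | add f g hf hg => exact map_add (E.toLeavitt R) f g ▸ add _ _ hf hg
  | single w r =>
    have hw : p (E.toLeavitt R (MonoidAlgebra.single w 1)) := by
      induction w using FreeSemigroup.recOnMul with
      | ih1 x => exact gen x
      | ih2 x w hx hw =>
        rw [← mul_one (1 : R), ← MonoidAlgebra.single_mul_single, map_mul]
        exact mul _ _ hx hw
    rw [← mul_one r, ← MonoidAlgebra.smul_single', toLeavitt_smul]
    exact smul _ _ hw

section Lift

variable {B : Type*} [Ring B] {φ : R →+* B} {g : E.Gen → B}

theorem commute_freeSemigroup_lift (hg : ∀ r x, Commute (φ r) (g x)) (r : R)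
    (w : FreeSemigroup E.Gen) : Commute (φ r) (FreeSemigroup.lift g w) := by
  induction w using FreeSemigroup.recOnMul with
  | ih1 x => exact hg r x
  | ih2 x w hx hw =>
    rw [map_mul]
    exact hx.mul_right hw

/-- The homomorphism from `R⟨X⟩` that is given by `φ` on scalars and by `g` on generators. -/
noncomputable def freeLift (φ : R →+* B) (g : E.Gen → B) (hg : ∀ r x, Commute (φ r) (g x)) :
    E.FreeRRing R →ₙ+* B where
  __ := MonoidAlgebra.liftNC (φ : R →+ B) (FreeSemigroup.lift g)
  map_mul' a b := MonoidAlgebra.liftNC_mul φ (FreeSemigroup.lift g) a b fun _ =>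
    commute_freeSemigroup_lift hg _ _

variable {hg : ∀ r x, Commute (φ r) (g x)}

theorem freeLift_single (w : FreeSemigroup E.Gen) (r : R) :
    freeLift φ g hg (MonoidAlgebra.single w r) = φ r * FreeSemigroup.lift g w :=
  MonoidAlgebra.liftNC_single _ _ _ _

theorem freeLift_ι (x : E.Gen) : freeLift φ g hg (E.ι R x) = g x := by
  rw [ι, freeLift_single, map_one, one_mul, FreeSemigroup.lift_of]

theorem freeLift_smul (r : R) (f : E.FreeRRing R) :
    freeLift φ g hg (r • f) = φ r * freeLift φ g hg f := by
  induction f using MonoidAlgebra.induction_linear with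
  | zero => simp
  | add f h hf hh => rw [smul_add, map_add, hf, hh, map_add, mul_add]
  | single w s =>
    rw [MonoidAlgebra.smul_single', freeLift_single, freeLift_single, map_mul, mul_assoc]

theorem freeLift_op_smul (r : R) (f : E.FreeRRing R) :
    freeLift φ g hg (MulOpposite.op r • f) = freeLift φ g hg f * φ r := by
  induction f using MonoidAlgebra.induction_linear with
  | zero => simp
  | add f h hf hh => rw [smul_add, map_add, hf, hh, map_add, add_mul]
  | single w s =>
    rw [MonoidAlgebra.smul_single, freeLift_single, freeLift_single, MulOpposite.smul_eq_mul_unop,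
      MulOpposite.unop_op, map_mul, mul_assoc, mul_assoc,
      (commute_freeSemigroup_lift hg r w).eq]

theorem relIdeal_le_ker_freeLift
    (h : ∀ a b, E.Rel R a b → freeLift φ g hg a = freeLift φ g hg b) :
    E.relIdeal R ≤ TwoSidedIdeal.ker (freeLift φ g hg) := by
  refine sInf_le ⟨fun a b hab => ?_, fun r a ha => ?_⟩
  · rw [TwoSidedIdeal.mem_ker, map_sub, h a b hab, sub_self]
  · rw [TwoSidedIdeal.mem_ker] at ha
    rw [TwoSidedIdeal.mem_ker, TwoSidedIdeal.mem_ker, freeLift_smul, freeLift_op_smul, ha,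
      mul_zero, zero_mul]
    exact ⟨rfl, rfl⟩

/-- The universal property of the weighted Leavitt path algebra. -/
noncomputable def lift (φ : R →+* B) (g : E.Gen → B) (hg : ∀ r x, Commute (φ r) (g x))
    (h : ∀ a b, E.Rel R a b → freeLift φ g hg a = freeLift φ g hg b) :
    E.LeavittPathAlgebra R →ₙ+* B where
  toFun := Quotient.lift (freeLift φ g hg) fun a b hab => by
    have hker := relIdeal_le_ker_freeLift h (toLeavitt_eq_iff.1 (Quotient.sound hab))
    rwa [TwoSidedIdeal.mem_ker, map_sub, sub_eq_zero] at hker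
  map_zero' := map_zero (freeLift φ g hg)
  map_add' := by
    rintro ⟨a⟩ ⟨b⟩
    exact map_add (freeLift φ g hg) a b
  map_mul' := by
    rintro ⟨a⟩ ⟨b⟩
    exact map_mul (freeLift φ g hg) a b

variable {h : ∀ a b, E.Rel R a b → freeLift φ g hg a = freeLift φ g hg b}

theorem lift_toLeavitt (f : E.FreeRRing R) :
    lift φ g hg h (E.toLeavitt R f) = freeLift φ g hg f :=
  rfl

theorem lift_toLeavitt_ι (x : E.Gen) : lift φ g hg h (E.toLeavitt R (E.ι R x)) = g x := by
  rw [lift_toLeavitt, freeLift_ι]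

theorem lift_smul (r : R) (x : E.LeavittPathAlgebra R) :
    lift φ g hg h (r • x) = φ r * lift φ g hg h x := by
  obtain ⟨f, rfl⟩ := toLeavitt_surjective x
  rw [← toLeavitt_smul, lift_toLeavitt, lift_toLeavitt, freeLift_smul]

end Lift

end LeavittPathAlgebra

section Bipartite

/-- The map `σ` selects a structured edge of maximal weight at every vertex that is not a sink. -/
structure IsMaxWeight (E : WeightedGraph V S) (σ : V → S) : Prop where
  s_eq : ∀ α, E.s (σ (E.s α)) = E.s α
  weight_le : ∀ α, E.ω α ≤ E.ω (σ (E.s α))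

theorem mem_out {v : V} {α : S} : α ∈ E.out v ↔ E.s α = v := by simp [out]

theorem weight_le_vertexWeight (α : S) : E.ω α ≤ E.vertexWeight (E.s α) :=
  Finset.le_sup (mem_out.2 rfl)

theorem exists_lt_weight {v : V} {i : ℕ} (hi : i < E.vertexWeight v) :
    ∃ α, E.s α = v ∧ i < E.ω α := by
  obtain ⟨α, hα, h⟩ := Finset.lt_sup_iff.1 hi
  exact ⟨α, mem_out.1 hα, h⟩

theorem exists_isMaxWeight (hS : Nonempty V → Nonempty S) : ∃ σ, E.IsMaxWeight σ := by
  have hmax (v : V) : ∃ α, ∀ β, E.s β = v → E.s α = v ∧ E.ω β ≤ E.ω α := by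
    by_cases hv : (E.out v).Nonempty
    · obtain ⟨α, hα, hmax⟩ := Finset.exists_max_image _ E.ω hv
      exact ⟨α, fun β hβ => ⟨mem_out.1 hα, hmax β (mem_out.2 hβ)⟩⟩
    · obtain ⟨α⟩ := hS ⟨v⟩
      exact ⟨α, fun β hβ => absurd ⟨β, mem_out.2 hβ⟩ hv⟩
  choose σ hσ using hmax
  exact ⟨σ, fun α => (hσ _ α rfl).1, fun α => (hσ _ α rfl).2⟩

variable {σ : V → S} {hσ : E.IsMaxWeight σ}

open Classical in
/-- The bipartite graph with an edge from the row `(v, i)` to the column `α` whenever `s α = v` and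
`i < ω α`. The arrow from `(v, i)` to `α` stands for `α_{i+1}`, and its inverse for `α_{i+1}*`. -/
noncomputable def bipartite (E : WeightedGraph V S) (hσ : E.IsMaxWeight σ) :
    PivotedGraph V (S ⊕ V × ℕ) where
  base := Sum.elim E.r Prod.fst
  nbr := Sum.elim (fun α => (Finset.range (E.ω α)).image fun i => inr (E.s α, i))
    fun x => {α ∈ E.out x.1 | x.2 < E.ω α}.image inl
  pivot := Sum.elim (fun α => inr (E.s α, 0)) fun x => inl (σ x.1)
  mem_nbr_symm := by
    rintro (α | ⟨v, i⟩) (β | ⟨w, j⟩) h <;> simp_all [mem_out]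
  pivot_mem_nbr := by
    rintro (α | ⟨v, i⟩) b h
    · exact Finset.mem_image_of_mem _ (Finset.mem_range.2 (E.ω_pos α))
    · obtain ⟨β, ⟨rfl, hi⟩, -⟩ : ∃ β, (E.s β = v ∧ i < E.ω β) ∧ inl β = b := by
        simpa [mem_out] using h
      simpa [mem_out] using ⟨hσ.s_eq β, hi.trans_le (hσ.weight_le β)⟩
  pivot_eq := by
    rintro (α | ⟨v, i⟩) (β | ⟨w, j⟩) (γ | ⟨u, k⟩) h h' <;> simp_all [mem_out]

theorem mem_nbr_inl {α : S} {b : S ⊕ V × ℕ} :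
    b ∈ (E.bipartite hσ).nbr (inl α) ↔ ∃ i < E.ω α, inr (E.s α, i) = b := by
  simp [bipartite]

theorem mem_nbr_inr {v : V} {i : ℕ} {b : S ⊕ V × ℕ} :
    b ∈ (E.bipartite hσ).nbr (inr (v, i)) ↔ ∃ α, (E.s α = v ∧ i < E.ω α) ∧ inl α = b := by
  simp [bipartite, mem_out]

theorem sum_nbr_inl {A : Type*} [AddCommMonoid A] {f : S ⊕ V × ℕ → A} {α : S} {k : ℕ}
    (hf : ∀ b ∉ (E.bipartite hσ).nbr (inl α), f b = 0) (hk : E.ω α ≤ k) :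
    ∑ b ∈ (E.bipartite hσ).nbr (inl α), f b = ∑ i ∈ Finset.range k, f (inr (E.s α, i)) := by
  classical
  have hinj : Function.Injective fun i : ℕ => (inr (E.s α, i) : S ⊕ V × ℕ) := fun i j h => by
    simpa using h
  refine (Finset.sum_image hinj.injOn).trans (Finset.sum_subset (by simpa using hk) ?_)
  intro i _ hi
  exact hf _ fun h => hi (by simpa [mem_nbr_inl] using h)

theorem sum_nbr_inr {A : Type*} [AddCommMonoid A] {f : S ⊕ V × ℕ → A} {v : V} {i : ℕ}
    (hf : ∀ b ∉ (E.bipartite hσ).nbr (inr (v, i)), f b = 0) :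
    ∑ b ∈ (E.bipartite hσ).nbr (inr (v, i)), f b = ∑ α ∈ E.out v, f (inl α) := by
  classical
  refine (Finset.sum_image Sum.inl_injective.injOn).trans
    (Finset.sum_subset (Finset.filter_subset _ _) ?_)
  intro α hα hi
  exact hf _ fun h => hi (Finset.mem_filter.2 ⟨hα, by simpa [mem_nbr_inr, mem_out.1 hα] using h⟩)

theorem isBranching_bipartite (hω : ∀ α, 2 ≤ E.ω α)
    (hcard : ∀ v, (E.out v).Nonempty →
      2 ≤ {α ∈ E.out v | E.ω α = E.vertexWeight v}.card) :
    (E.bipartite hσ).IsBranching := by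
  rintro (α | ⟨v, i⟩) b c hb hc
  · obtain ⟨i, -, rfl⟩ := mem_nbr_inl.1 hb
    obtain ⟨γ, ⟨hγ, -⟩, rfl⟩ := mem_nbr_inr.1 hc
    exact ⟨inr (E.s α, 1), by simp [bipartite], mem_nbr_inl.2 ⟨1, hω α, rfl⟩,
      mem_nbr_inl.2 ⟨1, hω γ, by rw [hγ]⟩⟩
  · obtain ⟨β, ⟨rfl, hi⟩, rfl⟩ := mem_nbr_inr.1 hb
    obtain ⟨j, hj, rfl⟩ := mem_nbr_inl.1 hc
    obtain ⟨δ, hδ, hne⟩ :=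
      Finset.exists_mem_ne (hcard (E.s β) ⟨β, mem_out.2 rfl⟩) (σ (E.s β))
    obtain ⟨hδ, hweight⟩ := Finset.mem_filter.1 hδ
    have hβδ : E.ω β ≤ E.ω δ := hweight ▸ weight_le_vertexWeight β
    exact ⟨inl δ, by simpa [bipartite] using hne,
      mem_nbr_inr.2 ⟨δ, ⟨mem_out.1 hδ, hi.trans_le hβδ⟩, rfl⟩,
      mem_nbr_inr.2 ⟨δ, ⟨mem_out.1 hδ, hj.trans_le hβδ⟩, rfl⟩⟩

end Bipartite

open scoped Classical

section Families

variable {σ : V → S} {hσ : E.IsMaxWeight σ}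

theorem edg_of_lt {α : S} {i : ℕ} (h : i < E.ω α) : E.edg R α i = E.ι R (.edge α ⟨i, h⟩) :=
  dif_pos h

theorem edg_of_not_lt {α : S} {i : ℕ} (h : ¬i < E.ω α) : E.edg R α i = 0 := dif_neg h

theorem gho_of_lt {α : S} {i : ℕ} (h : i < E.ω α) : E.gho R α i = E.ι R (.ghost α ⟨i, h⟩) :=
  dif_pos h

theorem gho_of_not_lt {α : S} {i : ℕ} (h : ¬i < E.ω α) : E.gho R α i = 0 := dif_neg h

variable (E R) in
/-- The generators of the weighted Leavitt path algebra as arrows of the graph `bipartite`. -/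
noncomputable def leavittArrow : S ⊕ V × ℕ → S ⊕ V × ℕ → E.LeavittPathAlgebra R
  | inr x, inl α => if x.1 = E.s α then E.toLeavitt R (E.edg R α x.2) else 0
  | inl α, inr x => if x.1 = E.s α then E.toLeavitt R (E.gho R α x.2) else 0
  | _, _ => 0

theorem leavittArrow_inr_inl {α : S} {v : V} (h : v = E.s α) (i : ℕ) :
    E.leavittArrow R (inr (v, i)) (inl α) = E.toLeavitt R (E.edg R α i) :=
  if_pos h

theorem leavittArrow_inl_inr {α : S} {v : V} (h : v = E.s α) (i : ℕ) :
    E.leavittArrow R (inl α) (inr (v, i)) = E.toLeavitt R (E.gho R α i) :=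
  if_pos h

theorem leavittArrow_eq_zero {a b : S ⊕ V × ℕ} (h : b ∉ (E.bipartite hσ).nbr a) :
    E.leavittArrow R a b = 0 := by
  rcases a with α | ⟨v, i⟩ <;> rcases b with β | ⟨w, j⟩
  · rfl
  · refine ite_eq_right_iff.2 ?_
    rintro rfl
    rw [gho_of_not_lt fun hj => h (mem_nbr_inl.2 ⟨j, hj, rfl⟩), map_zero]
  · refine ite_eq_right_iff.2 ?_
    rintro rfl
    rw [edg_of_not_lt fun hi => h (mem_nbr_inr.2 ⟨β, ⟨rfl, hi⟩, rfl⟩), map_zero]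
  · rfl

theorem vtx_mul_leavittArrow (a b : S ⊕ V × ℕ) :
    E.toLeavitt R (E.vtx R ((E.bipartite hσ).base a)) * E.leavittArrow R a b =
      E.leavittArrow R a b := by
  by_cases hb : b ∈ (E.bipartite hσ).nbr a
  · rcases a with α | ⟨v, i⟩
    · obtain ⟨i, hi, rfl⟩ := mem_nbr_inl.1 hb
      rw [leavittArrow_inl_inr rfl, ← map_mul]
      exact toLeavitt_eq_of_rel (.range_mul_ghost α i hi)
    · obtain ⟨α, ⟨rfl, hi⟩, rfl⟩ := mem_nbr_inr.1 hb
      rw [leavittArrow_inr_inl rfl, ← map_mul]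
      exact toLeavitt_eq_of_rel (.source_mul_edge α i hi)
  · rw [leavittArrow_eq_zero hb, mul_zero]

theorem leavittArrow_mul_vtx (a b : S ⊕ V × ℕ) :
    E.leavittArrow R a b * E.toLeavitt R (E.vtx R ((E.bipartite hσ).base b)) =
      E.leavittArrow R a b := by
  by_cases hb : b ∈ (E.bipartite hσ).nbr a
  · rcases a with α | ⟨v, i⟩
    · obtain ⟨i, hi, rfl⟩ := mem_nbr_inl.1 hb
      rw [leavittArrow_inl_inr rfl, ← map_mul]
      exact toLeavitt_eq_of_rel (.ghost_mul_source α i hi)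
    · obtain ⟨α, ⟨rfl, hi⟩, rfl⟩ := mem_nbr_inr.1 hb
      rw [leavittArrow_inr_inl rfl, ← map_mul]
      exact toLeavitt_eq_of_rel (.edge_mul_range α i hi)
  · rw [leavittArrow_eq_zero hb, zero_mul]

theorem sum_leavittArrow_inl (α : S) (c : S ⊕ V × ℕ) :
    ∑ b ∈ (E.bipartite hσ).nbr (inl α), E.leavittArrow R (inl α) b * E.leavittArrow R b c =
      if inl α = c then E.toLeavitt R (E.vtx R (E.r α)) else 0 := by
  have hsum {k : ℕ} := sum_nbr_inl (hσ := hσ) (α := α) (k := k)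
    (f := fun b => E.leavittArrow R (inl α) b * E.leavittArrow R b c)
    fun b hb => by rw [leavittArrow_eq_zero hb, zero_mul]
  rcases c with β | y
  · rw [hsum (le_max_left _ (E.ω β))]
    by_cases hs : E.s α = E.s β
    · simp only [leavittArrow_inl_inr, leavittArrow_inr_inl hs, ← map_mul, ← map_sum,
        toLeavitt_eq_of_rel (.sum_ghost_edge α β), Sum.inl.injEq, apply_ite (E.toLeavitt R),
        map_zero]
    · rw [if_neg fun h => hs (congrArg E.s (Sum.inl_injective h))]
      exact Finset.sum_eq_zero fun i _ =>
        mul_eq_zero_of_right _ (if_neg hs)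
  · rw [hsum le_rfl, if_neg Sum.inl_ne_inr]
    exact Finset.sum_eq_zero fun i _ => mul_zero _

theorem sum_leavittArrow_inr {v : V} {i : ℕ} (c : S ⊕ V × ℕ) (hi : i < E.vertexWeight v) :
    ∑ b ∈ (E.bipartite hσ).nbr (inr (v, i)),
        E.leavittArrow R (inr (v, i)) b * E.leavittArrow R b c =
      if inr (v, i) = c then E.toLeavitt R (E.vtx R v) else 0 := by
  rw [sum_nbr_inr fun b hb => by rw [leavittArrow_eq_zero hb, zero_mul]]
  rcases c with β | ⟨w, j⟩
  · rw [if_neg Sum.inr_ne_inl]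
    exact Finset.sum_eq_zero fun i _ => mul_zero _
  by_cases hvw : v = w ∧ j < E.vertexWeight v
  · obtain ⟨rfl, hj⟩ := hvw
    have hterm : ∀ α ∈ E.out v,
        E.leavittArrow R (inr (v, i)) (inl α) * E.leavittArrow R (inl α) (inr (v, j)) =
          E.toLeavitt R (E.edg R α i * E.gho R α j) := by
      intro α hα
      obtain rfl := mem_out.1 hα
      rw [leavittArrow_inr_inl rfl, leavittArrow_inl_inr rfl, map_mul]
    rw [Finset.sum_congr rfl hterm, ← map_sum, toLeavitt_eq_of_rel (.sum_edge_ghost v i j hi hj)]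
    simp only [Sum.inr.injEq, Prod.mk.injEq, true_and, apply_ite (E.toLeavitt R), map_zero]
  · rw [if_neg, Finset.sum_eq_zero]
    · intro α hα
      obtain rfl := mem_out.1 hα
      rw [leavittArrow_eq_zero (hσ := hσ) (a := inl α), mul_zero]
      intro h
      obtain ⟨j, hj, hwj⟩ := mem_nbr_inl.1 h
      obtain ⟨rfl, rfl⟩ : E.s α = w ∧ _ = _ := by simpa using hwj
      exact hvw ⟨rfl, hj.trans_le (weight_le_vertexWeight α)⟩
    · intro h
      obtain ⟨rfl, rfl⟩ : v = w ∧ i = j := by simpa using h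
      exact hvw ⟨rfl, hi⟩

variable (R) in
/-- The generators of the weighted Leavitt path algebra satisfy the relations between the vertices
and arrows of the graph `bipartite`. -/
noncomputable def leavittFamily (hσ : E.IsMaxWeight σ) :
    (E.bipartite hσ).LeavittFamily (E.LeavittPathAlgebra R) where
  vtx u := E.toLeavitt R (E.vtx R u)
  arrow := E.leavittArrow R
  vtx_mul_self u := by
    rw [← map_mul, toLeavitt_eq_of_rel (.vertex_mul u u), if_pos rfl]
  vtx_mul_of_ne {u w} h := by
    rw [← map_mul, toLeavitt_eq_of_rel (.vertex_mul u w), if_neg h, map_zero]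
  arrow_eq_zero := leavittArrow_eq_zero
  vtx_mul_arrow := vtx_mul_leavittArrow
  arrow_mul_vtx := leavittArrow_mul_vtx
  sum_arrow_mul_arrow {a} c ha := by
    rcases a with α | ⟨v, i⟩
    · convert sum_leavittArrow_inl α c
      rfl
    · obtain ⟨b, hb⟩ := ha
      obtain ⟨α, ⟨rfl, hi⟩, rfl⟩ := mem_nbr_inr.1 hb
      convert sum_leavittArrow_inr c (hi.trans_le (weight_le_vertexWeight α))
      rfl

theorem leavittFamily_induction (hσ : E.IsMaxWeight σ) {p : E.LeavittPathAlgebra R → Prop}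
    (vtx : ∀ u, p ((E.leavittFamily R hσ).vtx u))
    (arrow : ∀ a b, p ((E.leavittFamily R hσ).arrow a b))
    (zero : p 0) (add : ∀ x y, p x → p y → p (x + y)) (mul : ∀ x y, p x → p y → p (x * y))
    (smul : ∀ (r : R) x, p x → p (r • x)) (x : E.LeavittPathAlgebra R) : p x := by
  refine leavitt_induction (fun x => ?_) zero add mul smul x
  rcases x with u | ⟨α, i⟩ | ⟨α, i⟩
  · exact vtx u
  · rw [← edg_of_lt i.2, ← leavittArrow_inr_inl rfl]
    exact arrow (inr (E.s α, i)) (inl α)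
  · rw [← gho_of_lt i.2, ← leavittArrow_inl_inr rfl]
    exact arrow (inl α) (inr (E.s α, i))

section LiftFamily

variable {B : Type*} [Ring B] {φ : R →+* B} (F : (E.bipartite hσ).LeavittFamily B)

/-- The elements of the family that correspond to the generators. -/
def genImage : E.Gen → B
  | .vertex u => F.vtx u
  | .edge α i => F.arrow (inr (E.s α, i)) (inl α)
  | .ghost α i => F.arrow (inl α) (inr (E.s α, i))

variable {F} {hg : ∀ r x, Commute (φ r) (genImage F x)}

theorem freeLift_vtx (u : V) : freeLift φ (genImage F) hg (E.vtx R u) = F.vtx u :=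
  freeLift_ι _

theorem freeLift_edg (α : S) (i : ℕ) :
    freeLift φ (genImage F) hg (E.edg R α i) = F.arrow (inr (E.s α, i)) (inl α) := by
  by_cases hi : i < E.ω α
  · rw [edg_of_lt hi]
    exact freeLift_ι _
  · rw [edg_of_not_lt hi, map_zero, F.arrow_eq_zero]
    simpa [mem_nbr_inr] using hi

theorem freeLift_gho (α : S) (i : ℕ) :
    freeLift φ (genImage F) hg (E.gho R α i) = F.arrow (inl α) (inr (E.s α, i)) := by
  by_cases hi : i < E.ω α
  · rw [gho_of_lt hi]
    exact freeLift_ι _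
  · rw [gho_of_not_lt hi, map_zero, F.arrow_eq_zero]
    simpa [mem_nbr_inl] using hi

theorem sum_arrow_mul_arrow_inr {v : V} {i j : ℕ} (hi : i < E.vertexWeight v) :
    ∑ α ∈ E.out v, F.arrow (inr (E.s α, i)) (inl α) * F.arrow (inl α) (inr (E.s α, j)) =
      if i = j then F.vtx v else 0 := by
  obtain ⟨β, rfl, hβ⟩ := exists_lt_weight hi
  have hsum := F.sum_arrow_mul_arrow (a := inr (E.s β, i)) (inr (E.s β, j))
    ⟨inl β, mem_nbr_inr.2 ⟨β, ⟨rfl, hβ⟩, rfl⟩⟩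
  rw [sum_nbr_inr fun b hb => by rw [F.arrow_eq_zero hb, zero_mul]] at hsum
  rw [Finset.sum_congr rfl fun α hα => by rw [mem_out.1 hα], hsum]
  simp only [Sum.inr.injEq, Prod.mk.injEq, true_and]
  rfl

theorem sum_arrow_mul_arrow_inl (α β : S) :
    ∑ i ∈ Finset.range (max (E.ω α) (E.ω β)),
        F.arrow (inl α) (inr (E.s α, i)) * F.arrow (inr (E.s β, i)) (inl β) =
      if α = β then F.vtx (E.r α) else 0 := by
  by_cases hs : E.s α = E.s β
  · have hsum := F.sum_arrow_mul_arrow (a := inl α) (inl β)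
      ⟨_, mem_nbr_inl.2 ⟨0, E.ω_pos α, rfl⟩⟩
    rw [sum_nbr_inl (fun b hb => by rw [F.arrow_eq_zero hb, zero_mul])
      (le_max_left _ (E.ω β))] at hsum
    rw [← hs, hsum]
    simp only [Sum.inl.injEq]
    rfl
  · rw [if_neg fun h => hs (congrArg E.s h)]
    exact Finset.sum_eq_zero fun i _ => F.arrow_mul_arrow_of_ne hs

theorem freeLift_eq_of_rel {f g : E.FreeRRing R} (h : E.Rel R f g) :
    freeLift φ (genImage F) hg f = freeLift φ (genImage F) hg g := by
  cases h <;>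
    simp only [map_mul, map_sum, freeLift_vtx, freeLift_edg, freeLift_gho,
      apply_ite (freeLift φ (genImage F) hg), map_zero]
  case vertex_mul u w =>
    split_ifs with huw
    · rw [huw, F.vtx_mul_self]
    · exact F.vtx_mul_of_ne huw
  case source_mul_edge α i _ => exact F.vtx_mul_arrow (inr (E.s α, i)) _
  case edge_mul_range α _ _ => exact F.arrow_mul_vtx _ (inl α)
  case range_mul_ghost α _ _ => exact F.vtx_mul_arrow (inl α) _
  case ghost_mul_source α i _ => exact F.arrow_mul_vtx _ (inr (E.s α, i))
  case sum_edge_ghost hi _ => exact sum_arrow_mul_arrow_inr hi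
  case sum_ghost_edge α β => exact sum_arrow_mul_arrow_inl α β

end LiftFamily

end Families

section Representation

variable {σ : V → S} {hσ : E.IsMaxWeight σ} {v : V}

variable (R) in
/-- The regular family as additive operators. The representation `rep` has to take values in these,
since the scalars in `R` need not act by `R`-linear maps. -/
noncomputable def additiveFamily (hσ : E.IsMaxWeight σ) (v : V) :
    (E.bipartite hσ).LeavittFamily (AddMonoid.End ((E.bipartite hσ).PathModule R v)) :=
  ((E.bipartite hσ).regularFamily R v).map
    (Module.toAddMonoidEnd (Module.End R ((E.bipartite hσ).PathModule R v)) _).toNonUnitalRingHom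

theorem commute_genImage (r : R) (x : E.Gen) :
    Commute (Module.toAddMonoidEnd R ((E.bipartite hσ).PathModule R v) r)
      (genImage (additiveFamily R hσ v) x) := by
  cases x with
  | vertex u => exact AddMonoidHom.ext fun m => (map_smul ((E.bipartite hσ).proj R v u) r m).symm
  | edge α i => exact AddMonoidHom.ext fun m => (map_smul ((E.bipartite hσ).act R v _ _) r m).symm
  | ghost α i => exact AddMonoidHom.ext fun m => (map_smul ((E.bipartite hσ).act R v _ _) r m).symm

variable (R) in
/-- The action of the weighted Leavitt path algebra on the path module. -/
noncomputable def rep (hσ : E.IsMaxWeight σ) (v : V) :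
    E.LeavittPathAlgebra R →ₙ+* AddMonoid.End ((E.bipartite hσ).PathModule R v) :=
  lift (Module.toAddMonoidEnd R _) (genImage (additiveFamily R hσ v)) commute_genImage
    fun _ _ => freeLift_eq_of_rel

theorem rep_zero (m : (E.bipartite hσ).PathModule R v) : E.rep R hσ v 0 m = 0 :=
  DFunLike.congr_fun (map_zero (E.rep R hσ v)) m

theorem rep_add (x y : E.LeavittPathAlgebra R) (m : (E.bipartite hσ).PathModule R v) :
    E.rep R hσ v (x + y) m = E.rep R hσ v x m + E.rep R hσ v y m :=
  DFunLike.congr_fun (map_add (E.rep R hσ v) x y) m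

theorem rep_mul (x y : E.LeavittPathAlgebra R) (m : (E.bipartite hσ).PathModule R v) :
    E.rep R hσ v (x * y) m = E.rep R hσ v x (E.rep R hσ v y m) :=
  DFunLike.congr_fun (map_mul (E.rep R hσ v) x y) m

theorem rep_smul (r : R) (x : E.LeavittPathAlgebra R) (m : (E.bipartite hσ).PathModule R v) :
    E.rep R hσ v (r • x) m = r • E.rep R hσ v x m :=
  DFunLike.congr_fun (lift_smul r x) m

theorem rep_vtx (u : V) (m : (E.bipartite hσ).PathModule R v) :
    E.rep R hσ v ((E.leavittFamily R hσ).vtx u) m = (E.bipartite hσ).proj R v u m :=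
  DFunLike.congr_fun (lift_toLeavitt_ι (.vertex u)) m

theorem rep_edg (α : S) (i : ℕ) (m : (E.bipartite hσ).PathModule R v) :
    E.rep R hσ v (E.toLeavitt R (E.edg R α i)) m =
      (E.bipartite hσ).act R v (inr (E.s α, i)) (inl α) m :=
  DFunLike.congr_fun ((lift_toLeavitt _).trans (freeLift_edg α i)) m

theorem rep_gho (α : S) (i : ℕ) (m : (E.bipartite hσ).PathModule R v) :
    E.rep R hσ v (E.toLeavitt R (E.gho R α i)) m =
      (E.bipartite hσ).act R v (inl α) (inr (E.s α, i)) m :=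
  DFunLike.congr_fun ((lift_toLeavitt _).trans (freeLift_gho α i)) m

theorem rep_arrow (a b : S ⊕ V × ℕ) (m : (E.bipartite hσ).PathModule R v) :
    E.rep R hσ v ((E.leavittFamily R hσ).arrow a b) m = (E.bipartite hσ).act R v a b m := by
  by_cases hb : b ∈ (E.bipartite hσ).nbr a
  · change E.rep R hσ v (E.leavittArrow R a b) m = _
    rcases a with α | ⟨v, i⟩
    · obtain ⟨i, -, rfl⟩ := mem_nbr_inl.1 hb
      rw [leavittArrow_inl_inr rfl, rep_gho]
    · obtain ⟨α, ⟨rfl, -⟩, rfl⟩ := mem_nbr_inr.1 hb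
      rw [leavittArrow_inr_inl rfl, rep_edg]
  · rw [(E.leavittFamily R hσ).arrow_eq_zero hb, act_eq_zero hb, map_zero]
    rfl

theorem rep_wordProd (u : V) (p : List ((S ⊕ V × ℕ) × (S ⊕ V × ℕ)))
    (m : (E.bipartite hσ).PathModule R v) :
    E.rep R hσ v ((E.leavittFamily R hσ).wordProd u p) m =
      (E.bipartite hσ).actWord R v p ((E.bipartite hσ).proj R v u m) := by
  induction p with
  | nil => exact rep_vtx u m
  | cons x p ih =>
    rw [LeavittFamily.wordProd, rep_mul, ih, rep_arrow, actWord_cons,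
      Module.End.mul_apply]

theorem vtx_mul_smul (u : V) (r : R) (x : E.LeavittPathAlgebra R) :
    (E.leavittFamily R hσ).vtx u * r • x = r • ((E.leavittFamily R hσ).vtx u * x) :=
  toLeavitt_ι_mul_smul _ r x

theorem arrow_mul_smul (a b : S ⊕ V × ℕ) (r : R) (x : E.LeavittPathAlgebra R) :
    (E.leavittFamily R hσ).arrow a b * r • x = r • ((E.leavittFamily R hσ).arrow a b * x) := by
  by_cases hb : b ∈ (E.bipartite hσ).nbr a
  · change E.leavittArrow R a b * r • x = r • (E.leavittArrow R a b * x)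
    rcases a with α | ⟨v, i⟩
    · obtain ⟨i, hi, rfl⟩ := mem_nbr_inl.1 hb
      rw [leavittArrow_inl_inr rfl, gho_of_lt hi, toLeavitt_ι_mul_smul]
    · obtain ⟨α, ⟨rfl, hi⟩, rfl⟩ := mem_nbr_inr.1 hb
      rw [leavittArrow_inr_inl rfl, edg_of_lt hi, toLeavitt_ι_mul_smul]
  · rw [(E.leavittFamily R hσ).arrow_eq_zero hb, zero_mul, zero_mul, smul_zero]

theorem eval_rep (x : E.LeavittPathAlgebra R) (m : (E.bipartite hσ).PathModule R v) :
    (E.leavittFamily R hσ).eval R v (E.rep R hσ v x m) =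
      x * (E.leavittFamily R hσ).eval R v m := by
  induction x using leavittFamily_induction hσ generalizing m with
  | vtx u => rw [rep_vtx, LeavittFamily.eval_proj _ vtx_mul_smul]
  | arrow a b => rw [rep_arrow, LeavittFamily.eval_act _ arrow_mul_smul]
  | zero => rw [rep_zero, zero_mul, map_zero]
  | add x y hx hy => rw [rep_add, add_mul, ← hx, ← hy, map_add]
  | mul x y hx hy => rw [rep_mul, hx, hy, mul_assoc]
  | smul r x hx => rw [rep_smul, map_smul, hx, smul_mul]

theorem eval_rep_word_nil (x : E.LeavittPathAlgebra R) :
    (E.leavittFamily R hσ).eval R v (E.rep R hσ v x ((E.bipartite hσ).word R v [])) =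
      x * (E.leavittFamily R hσ).vtx v := by
  rw [eval_rep, LeavittFamily.eval_word _ isNormal_nil, LeavittFamily.wordProd]

theorem eventually_sum_mul_vtx_eq (hσ : E.IsMaxWeight σ) (x : E.LeavittPathAlgebra R) :
    ∀ᶠ t in (atTop : Filter (Finset V)), ∑ u ∈ t, x * (E.leavittFamily R hσ).vtx u = x := by
  induction x using leavittFamily_induction hσ with
  | vtx u =>
    filter_upwards [eventually_ge_atTop {u}] with t ht
    exact LeavittFamily.sum_mul_vtx _ (LeavittFamily.vtx_mul_self _ u)
      (Finset.singleton_subset_iff.1 ht)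
  | arrow a b =>
    filter_upwards [eventually_ge_atTop {(E.bipartite hσ).base b}] with t ht
    exact LeavittFamily.sum_mul_vtx _ (LeavittFamily.arrow_mul_vtx _ a b)
      (Finset.singleton_subset_iff.1 ht)
  | zero => simp
  | add x y hx hy =>
    filter_upwards [hx, hy] with t hx hy
    simp only [add_mul, Finset.sum_add_distrib, hx, hy]
  | mul x y _ hy =>
    filter_upwards [hy] with t hy
    simp only [mul_assoc, ← Finset.mul_sum, hy]
  | smul r x hx =>
    filter_upwards [hx] with t hx
    simp only [smul_mul, ← Finset.smul_sum, hx]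

theorem exists_rep_word_nil_ne_zero (hσ : E.IsMaxWeight σ) {x : E.LeavittPathAlgebra R}
    (hx : x ≠ 0) : ∃ v, E.rep R hσ v x ((E.bipartite hσ).word R v []) ≠ 0 := by
  by_contra! hzero
  have hvtx (u : V) : x * (E.leavittFamily R hσ).vtx u = 0 := by
    rw [← eval_rep_word_nil, hzero, map_zero]
  obtain ⟨t, ht⟩ := (eventually_sum_mul_vtx_eq hσ x).exists
  exact hx (by rw [← ht, Finset.sum_eq_zero fun u _ => hvtx u])

theorem rep_eval (n : (E.bipartite hσ).PathModule R v) {m : (E.bipartite hσ).PathModule R v}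
    (hm : (E.bipartite hσ).proj R v v m = m) :
    E.rep R hσ v ((E.leavittFamily R hσ).eval R v n) m = (E.bipartite hσ).mulRight R v m n := by
  let repEval : (E.bipartite hσ).PathModule R v →ₗ[R] (E.bipartite hσ).PathModule R v :=
    { toFun := fun n => E.rep R hσ v ((E.leavittFamily R hσ).eval R v n) m
      map_add' := fun n n' => by rw [map_add, rep_add]
      map_smul' := fun r n => by rw [map_smul, rep_smul, RingHom.id_apply] }
  have hhom : repEval = (E.bipartite hσ).mulRight R v m := pathModule_hom_ext fun l hl => by
    rw [mulRight_word hl]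
    change E.rep R hσ v ((E.leavittFamily R hσ).eval R v _) m = _
    rw [LeavittFamily.eval_word _ hl, rep_wordProd, hm]
  exact LinearMap.congr_fun hhom n

theorem rep_eq_mulRight (x : E.LeavittPathAlgebra R) {m : (E.bipartite hσ).PathModule R v}
    (hm : (E.bipartite hσ).proj R v v m = m) :
    E.rep R hσ v x m =
      (E.bipartite hσ).mulRight R v m (E.rep R hσ v x ((E.bipartite hσ).word R v [])) := by
  rw [← rep_eval _ hm, eval_rep_word_nil, rep_mul, rep_vtx, hm]

theorem exists_not_isLeftQuasiregular_mul [NoZeroDivisors R]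
    (hbranch : (E.bipartite hσ).IsBranching) (hinc : ∀ v, ∃ α, E.s α = v ∨ E.r α = v)
    {x : E.LeavittPathAlgebra R} (hx : x ≠ 0) : ∃ y, ¬IsLeftQuasiregular (y * x) := by
  obtain ⟨v, hv⟩ := exists_rep_word_nil_ne_zero hσ hx
  have hnode : ∃ a b, b ∈ (E.bipartite hσ).nbr a ∧ (E.bipartite hσ).base a = v := by
    obtain ⟨α, rfl | rfl⟩ := hinc v
    · exact ⟨inr (E.s α, 0), inl α, mem_nbr_inr.2 ⟨α, ⟨rfl, E.ω_pos α⟩, rfl⟩, rfl⟩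
    · exact ⟨inl α, inr (E.s α, 0), mem_nbr_inl.2 ⟨0, E.ω_pos α, rfl⟩, rfl⟩
  obtain ⟨u, p, hproj, hdeg⟩ := exists_actWord_one_le_degree hbranch hnode hv
  refine ⟨(E.leavittFamily R hσ).wordProd u p, fun ⟨z, hz⟩ => ?_⟩
  have hz' := DFunLike.congr_fun (congrArg (E.rep R hσ v) hz) ((E.bipartite hσ).word R v [])
  rw [rep_add, rep_mul z, rep_mul, rep_wordProd, rep_eq_mulRight z hproj] at hz'
  exact add_ne_mulRight_of_one_le_degree hbranch hproj hdeg _ hz'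

end Representation

theorem IsLVGraph.exists_incident (hE : E.IsLVGraph) (v : V) : ∃ α, E.s α = v ∨ E.r α = v := by
  obtain ⟨α⟩ := hE.has_edges
  rcases Relation.ReflTransGen.cases_tail (hE.connected (E.s α) v) with h | ⟨u, -, β, -, h | h⟩
  · exact ⟨α, .inl h.symm⟩
  · exact ⟨β, .inr h.2⟩
  · exact ⟨β, .inl h.2⟩

end WeightedGraph

theorem mainTheorem10_general {V S : Type*} (E : WeightedGraph V S)
    (hweight : ∀ α, 2 ≤ E.ω α)
    (hcard : ∀ v, (E.out v).Nonempty → 2 ≤ {α ∈ E.out v | E.ω α = E.vertexWeight v}.card)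
    (hincident : ∀ v, ∃ α, E.s α = v ∨ E.r α = v) (R : Type*) [Ring R] [NoZeroDivisors R] :
    jacobsonRadical (E.LeavittPathAlgebra R) = ⊥ := by
  obtain ⟨σ, hσ⟩ := WeightedGraph.exists_isMaxWeight (E := E)
    fun ⟨v⟩ => (hincident v).nonempty
  have hbranch : (E.bipartite hσ).IsBranching :=
    WeightedGraph.isBranching_bipartite hweight hcard
  exact jacobsonRadical_eq_bot_of_exists_mul fun x hx =>
    WeightedGraph.exists_not_isLeftQuasiregular_mul hbranch hincident hx

theorem mainTheorem10 {V S : Type*} [Countable V] [Countable S] (E : WeightedGraph V S)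
    (hE : E.IsLVGraph) (R : Type*) [Ring R] [IsDomain R] :
    jacobsonRadical (E.LeavittPathAlgebra R) = ⊥ :=
  mainTheorem10_general E hE.two_le_weight hE.two_le_card hE.exists_incident R
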